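/- A Hamilton cycle of a finite simple graph $G$ is a cycle in $G$ through all vertices of $G$; let $h(G)$ denote the number of Hamilton cycles of $G$, counted as subgraphs of $G$. For every real $c>1/2$ there exist $\varepsilon_0>0$ and a function $\varepsilon\mapsto\varepsilon'(\varepsilon)$ with $\varepsilon'(\varepsilon)\to 0$ as $\varepsilon\to 0^+$ such that for every $0<\varepsilon<\varepsilon_0$ we have $0<\varepsilon'(\varepsilon)<c$, and there is an integer $N$ (depending on $c$ and $\varepsilon$) such that the following holds for all $n\ge N$. If $G$ is a simple graph on $n$ vertices with $$(c-\varepsilon)n<d(v)<(c+\varepsilon)n\quad\text{for every vertex } v,$$ then $$\left(\frac{(c-\varepsilon'(\varepsilon))n}{e}\right)^n<h(G)<\left(\frac{(c+\varepsilon'(\varepsilon))n}{e}\right)^n .$$ -/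

import Mathlib

open Filter Topology

/-- The number `h(G)` of Hamilton cycles of `G`, a Hamilton cycle being a subgraph of `G` that is
traced by some Hamiltonian closed walk (so neither the starting vertex nor the direction of
traversal matters). -/
noncomputable def numHamiltonCycles {V : Type*} [DecidableEq V] (G : SimpleGraph V) : ℕ :=
  {H : G.Subgraph | ∃ (v : V) (p : G.Walk v v), p.IsHamiltonianCycle ∧ p.toSubgraph = H}.ncard

/-! Count the permutations `σ` with `v ~ σ v` for all `v` (`adjPerms`), whose number is the
permanent of the adjacency matrix. Each Hamilton cycle comes from such a permutation, so Brégman's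
theorem gives the upper bound.

For the lower bound, `c > 1/2` forces every two vertices to have linearly many common neighbours.
Hence the adjacency matrix can be perturbed slightly on its support so that all row and column sums
agree (`Matrix.exists_equal_row_sums`). A van der Waerden bound with constant `e⁻ⁿ`, proved by
Gurvits' capacity method for stable polynomials, then gives about `(cn/e)ⁿ` permutations
(`pow_le_mul_card_adjPerms`).

It remains to show that one-cycle permutations are an `e^(-o(n))` proportion. By Burnside's lemma,
permutations with at least `θn` cycles are negligible among all `n!`
(`card_numCycles_ge_mul_pow_le`). For fewer cycles, a switching argument merges two cycles: there
are order `k n²` switchings from a permutation with `k + 1` cycles and at most `2n³` into each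
target (`card_mul_crossings_le`). Going down to one cycle thus costs at most `(Cn)^k / k!`, which is
`e^(o(n))` when `k ≤ θn` with `θ → 0`. A one-cycle permutation is a directed Hamilton cycle. -/

namespace MvPolynomial

/-! ### Stable polynomials and Gurvits' capacity inequality -/

variable {σ : Type*}

/-- A real polynomial without zeros in the product of open right half planes. -/
def HStable (p : MvPolynomial σ ℝ) : Prop :=
  ∀ z : σ → ℂ, (∀ i, 0 < (z i).re) → aeval z p ≠ 0

/-- The restriction of `p` to the line through `z` in the direction of the variable `k`. -/
noncomputable def lineRestrict [DecidableEq σ] (p : MvPolynomial σ ℝ) (z : σ → ℂ) (k : σ) :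
    Polynomial ℂ :=
  aeval (fun i => Polynomial.C (z i) + if i = k then Polynomial.X else 0) p

theorem eval_lineRestrict [DecidableEq σ] (p : MvPolynomial σ ℝ) (z : σ → ℂ) (k : σ) (t : ℂ) :
    (lineRestrict p z k).eval t = aeval (fun i => z i + if i = k then t else 0) p := by
  induction p using MvPolynomial.induction_on with
  | C a => simp [lineRestrict]
  | add p q hp hq => simp only [lineRestrict, map_add, Polynomial.eval_add] at *; rw [hp, hq]
  | mul_X p i hp =>
    simp only [lineRestrict, map_mul, Polynomial.eval_mul, aeval_X] at *
    rw [hp]; split_ifs <;> simp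

theorem derivative_lineRestrict [DecidableEq σ] (p : MvPolynomial σ ℝ) (z : σ → ℂ) (k : σ) :
    Polynomial.derivative (lineRestrict p z k) = lineRestrict (pderiv k p) z k := by
  induction p using MvPolynomial.induction_on with
  | C a =>
    simp [lineRestrict, Polynomial.algebraMap_eq, IsScalarTower.algebraMap_apply ℝ ℂ (Polynomial ℂ)]
  | add p q hp hq => simp only [lineRestrict, map_add] at *; rw [hp, hq]
  | mul_X p i hp =>
    simp only [lineRestrict, map_mul, aeval_X, Polynomial.derivative_mul, Derivation.leibniz,
      smul_eq_mul, map_add] at *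
    rw [hp]
    by_cases h : i = k
    · subst h; simp; ring
    · simp [h, pderiv_X_of_ne h]; ring

theorem aeval_smul_of_isHomogeneous {p : MvPolynomial σ ℝ} {d : ℕ} (hp : p.IsHomogeneous d)
    (c : ℂ) (z : σ → ℂ) : aeval (fun i => c * z i) p = c ^ d * aeval z p := by
  rw [aeval_def, aeval_def, eval₂_eq, eval₂_eq, Finset.mul_sum]
  refine Finset.sum_congr rfl fun m hm => ?_
  have hd : m.degree = d := by
    by_contra h
    exact (mem_support_iff.mp hm) (hp.coeff_eq_zero h)
  rw [← hd]
  simp only [mul_pow, Finset.prod_mul_distrib, Finset.prod_pow_eq_pow_sum, Finsupp.degree_apply]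
  ring

theorem aeval_ofReal (p : MvPolynomial σ ℝ) (x : σ → ℝ) :
    aeval (fun i => (x i : ℂ)) p = ((eval x p : ℝ) : ℂ) := by
  induction p using MvPolynomial.induction_on with
  | C a => simp
  | add p q hp hq => simp [hp, hq]
  | mul_X p i hp => simp [hp]

/-- A homogeneous stable polynomial of degree `d` all of whose coefficients in degree `d` are
positive. -/
structure PosStable (d : ℕ) (p : MvPolynomial σ ℝ) : Prop where
  homogeneous : p.IsHomogeneous d
  coeff_pos : ∀ m : σ →₀ ℕ, m.degree = d → 0 < coeff m p
  stable : p.HStable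

namespace PosStable

variable {d : ℕ} {p : MvPolynomial σ ℝ}

theorem coeff_nonneg (hp : PosStable d p) (m : σ →₀ ℕ) : 0 ≤ coeff m p := by
  by_cases h : m.degree = d
  · exact (hp.coeff_pos m h).le
  · rw [hp.homogeneous.coeff_eq_zero h]

theorem eval_pos (hp : PosStable d p) {x : σ → ℝ} (hx : ∀ i, 0 ≤ x i) {j : σ} (hj : 0 < x j) :
    0 < eval x p := by
  rw [eval_eq]
  have h0 : 0 < coeff (Finsupp.single j d) p := hp.coeff_pos _ (by simp [Finsupp.degree_single])
  refine Finset.sum_pos' (fun m _ => mul_nonneg (hp.coeff_nonneg m)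
    (Finset.prod_nonneg fun i _ => pow_nonneg (hx i) _))
    ⟨Finsupp.single j d, mem_support_iff.mpr h0.ne', mul_pos h0 (Finset.prod_pos fun i hi => ?_)⟩
  have := Finsupp.support_single_subset hi
  rw [Finset.mem_singleton] at this
  subst this
  exact pow_pos hj _

/-- If `p` were constant `a` on the line, homogeneity would give `p(sz + e_k) = s^(d+1) a` for `s ≠
0`. Letting `s → 0` yields `p(e_k) = 0`, against positivity of the coefficients. -/
theorem lineRestrict_degree_pos [DecidableEq σ] (hp : PosStable (d + 1) p) (z : σ → ℂ) (k : σ) :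
    0 < (lineRestrict p z k).degree := by
  by_contra hcon
  have hC := Polynomial.eq_C_of_degree_le_zero (not_lt.mp hcon)
  set a := (lineRestrict p z k).coeff 0
  have hev : ∀ t : ℂ, aeval (fun i => z i + if i = k then t else 0) p = a := by
    intro t
    rw [← eval_lineRestrict, hC, Polynomial.eval_C]
  have hcont : Continuous fun s : ℂ => aeval (fun i => s * z i + if i = k then (1:ℂ) else 0) p := by
    simp only [aeval_def, eval₂_eq]
    fun_prop
  have key : (fun s : ℂ => aeval (fun i => s * z i + if i = k then (1:ℂ) else 0) p)
      = fun s => s ^ (d + 1) * a := by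
    refine hcont.ext_on (dense_compl_singleton (0:ℂ)) (by fun_prop) ?_
    intro s hs
    have hs : s ≠ 0 := by simpa using hs
    simp only
    rw [← hev s⁻¹, ← aeval_smul_of_isHomogeneous hp.homogeneous]
    congr 2
    ext i
    split_ifs <;> simp [mul_add, hs]
  have h0 := congrFun key 0
  have h1 := aeval_ofReal p (fun i => if i = k then (1:ℝ) else 0)
  have h2 := hp.eval_pos (x := fun i => if i = k then (1:ℝ) else 0)
    (fun i => by split_ifs <;> norm_num) (j := k) (by simp)
  have h3 : (fun i => (((if i = k then (1:ℝ) else 0 : ℝ)) : ℂ))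
      = fun i => if i = k then (1:ℂ) else 0 := by
    ext i; split_ifs <;> simp
  rw [h3] at h1
  simp only [zero_mul, zero_add, ne_eq, Nat.add_eq_zero_iff, one_ne_zero, and_false,
    not_false_eq_true, zero_pow] at h0
  rw [h1] at h0
  exact h2.ne' (by exact_mod_cast h0)

/-- Stability survives by Gauss–Lucas: the roots of the restriction lie in the half plane `re w ≤
-re z_k`, hence so do those of its derivative, and `0` is not there. -/
theorem pderiv [DecidableEq σ] (hp : PosStable (d + 1) p) (k : σ) :
    PosStable d (MvPolynomial.pderiv k p) where
  homogeneous := by simpa using hp.homogeneous.pderiv (i := k)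
  coeff_pos m hm := by
    rw [coeff_pderiv]
    refine mul_pos (hp.coeff_pos _ ?_) (by positivity)
    rw [map_add, hm, Finsupp.degree_single]
  stable z hz h0 := by
    have hroot : (0:ℂ) ∈ (Polynomial.derivative (lineRestrict p z k)).rootSet ℂ := by
      rw [Polynomial.mem_rootSet]
      constructor
      · intro h
        have := Polynomial.derivative_eq_zero.mp h
        have h2 := Polynomial.natDegree_pos_iff_degree_pos.mpr (hp.lineRestrict_degree_pos z k)
        omega
      · rw [derivative_lineRestrict, Polynomial.coe_aeval_eq_eval, eval_lineRestrict]
        simpa using h0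
    have hull := Polynomial.rootSet_derivative_subset_convexHull_rootSet
      (hp.lineRestrict_degree_pos z k) hroot
    have hsub : (lineRestrict p z k).rootSet ℂ ⊆ {w : ℂ | w.re ≤ -(z k).re} := by
      intro w hw
      rw [Polynomial.mem_rootSet] at hw
      by_contra hlt
      simp only [Set.mem_ofPred_eq, not_le] at hlt
      refine hp.stable (fun i => z i + if i = k then w else 0) (fun i => ?_) ?_
      · by_cases h : i = k
        · subst h; simp; linarith
        · simpa [h] using hz i
      · rw [← eval_lineRestrict]; simpa using hw.2
    have hconv : Convex ℝ {w : ℂ | w.re ≤ -(z k).re} := convex_halfSpace_re_le _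
    have := convexHull_min hsub hconv hull
    simp only [Set.mem_ofPred_eq, Complex.zero_re] at this
    linarith [hz k]

theorem root_neg [DecidableEq σ] (hp : PosStable d p) {x : σ → ℝ} (hx : ∀ i, 0 < x i) (k : σ)
    {w : ℂ} (hw : (lineRestrict p (fun i => x i) k).eval w = 0) : w.im = 0 ∧ w.re < 0 := by
  rw [eval_lineRestrict] at hw
  have him : w.im = 0 := by
    by_contra him
    -- Rotating by `α = 1 - i l` gives coordinate `k` real part `1` and leaves the real parts of the
    -- other, real coordinates at `x i`, contradicting stability.
    set l : ℝ := (1 - (x k + w.re)) / w.im with hl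
    set α : ℂ := ⟨1, -l⟩ with hα
    have h1 := aeval_smul_of_isHomogeneous hp.homogeneous α (fun i => (x i : ℂ) + if i = k then w else 0)
    rw [hw, mul_zero] at h1
    refine hp.stable _ (fun i => ?_) h1
    by_cases h : i = k
    · subst h
      have : l * w.im = 1 - (x i + w.re) := by rw [hl]; field_simp
      simp [hα]
      linarith
    · simpa [h, hα] using hx i
  refine ⟨him, ?_⟩
  by_contra hre
  refine hp.stable _ (fun i => ?_) hw
  by_cases h : i = k
  · subst h
    have := hx i
    simp
    linarith
  · simpa [h] using hx i

end PosStable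

/-- Factor by factor this is `t + r ≤ r * exp (t / r)`, where `w = -r`. -/
theorem _root_.Multiset.prod_norm_sub_le_exp (s : Multiset ℂ) (hs : ∀ w ∈ s, w.im = 0 ∧ w.re < 0)
    {t : ℝ} (ht : 0 ≤ t) :
    ‖(s.map (fun w => (t : ℂ) - w)).prod‖ ≤ ‖(s.map (fun w => (0 : ℂ) - w)).prod‖ *
      Real.exp (t * ((s.map (fun w => 1 / ((0 : ℂ) - w))).sum).re) := by
  induction s using Multiset.induction_on with
  | empty => simp
  | cons w s ih =>
    obtain ⟨h1, h2⟩ := hs w (by simp)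
    have ih := ih fun v hv => hs v (by simp [hv])
    simp only [Multiset.map_cons, Multiset.prod_cons, norm_mul, Multiset.sum_cons, Complex.add_re,
      mul_add, Real.exp_add]
    obtain ⟨r, hr, rfl⟩ : ∃ r : ℝ, 0 < r ∧ w = ((-r : ℝ) : ℂ) :=
      ⟨-w.re, by linarith, by apply Complex.ext <;> simp [h1]⟩
    have e1 : ‖(t : ℂ) - ((-r : ℝ) : ℂ)‖ = t + r := by
      rw [← Complex.ofReal_sub, Complex.norm_real, Real.norm_of_nonneg (by linarith)]; ring
    have e2 : ‖(0 : ℂ) - ((-r : ℝ) : ℂ)‖ = r := by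
      rw [zero_sub, norm_neg, Complex.norm_real, Real.norm_eq_abs, abs_neg, abs_of_pos hr]
    have e3 : (1 / ((0 : ℂ) - ((-r : ℝ) : ℂ))).re = 1 / r := by
      rw [show (1 / ((0 : ℂ) - ((-r : ℝ) : ℂ))) = ((1 / r : ℝ) : ℂ) by push_cast; ring]
      exact Complex.ofReal_re _
    rw [e1, e2, e3]
    have e4 : t + r ≤ r * Real.exp (t * (1 / r)) := by
      have := Real.add_one_le_exp (t * (1 / r))
      calc t + r = r * (t * (1 / r) + 1) := by field_simp
        _ ≤ _ := by gcongr
    calc (t + r) * ‖(s.map (fun w => (t : ℂ) - w)).prod‖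
        ≤ (r * Real.exp (t * (1 / r))) * _ := mul_le_mul e4 ih (norm_nonneg _) (by positivity)
      _ = _ := by ring

/-- The restriction to the line has only negative real roots, and the sum of their negated
reciprocals is its logarithmic derivative at `0`, namely `∂ₖp / p`. -/
theorem PosStable.eval_add_le_of_pos [DecidableEq σ] {d : ℕ} {p : MvPolynomial σ ℝ}
    (hp : PosStable d p) {x : σ → ℝ} (hx : ∀ i, 0 < x i) (k : σ) {t : ℝ} (ht : 0 ≤ t) :
    eval (fun i => x i + if i = k then t else 0) p ≤
      eval x p * Real.exp (t * (eval x (MvPolynomial.pderiv k p) / eval x p)) := by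
  set L := lineRestrict p (fun i => (x i : ℂ)) k with hL
  have hsp := IsAlgClosed.splits L
  have hLt : ∀ t : ℝ, L.eval (t : ℂ) = ((eval (fun i => x i + if i = k then t else 0) p : ℝ) : ℂ) := by
    intro t
    rw [hL, eval_lineRestrict, ← aeval_ofReal]
    congr 2
    ext i
    split_ifs <;> simp
  have hL0 : L.eval 0 = ((eval x p : ℝ) : ℂ) := by
    have := hLt 0
    simpa using this
  have hD0 : L.derivative.eval 0 = ((eval x (MvPolynomial.pderiv k p) : ℝ) : ℂ) := by
    rw [hL, derivative_lineRestrict, eval_lineRestrict, ← aeval_ofReal]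
    simp
  have hpos : 0 < eval x p := hp.eval_pos (fun i => (hx i).le) (hx k)
  have hpos' : 0 < eval (fun i => x i + if i = k then t else 0) p :=
    hp.eval_pos (fun i => by have := (hx i).le; split_ifs <;> linarith) (j := k)
      (by have := hx k; simp; linarith)
  have hne : L.eval 0 ≠ 0 := by rw [hL0]; exact_mod_cast hpos.ne'
  have hlog := hsp.eval_derivative_div_eval_of_ne_zero hne
  rw [hD0, hL0, ← Complex.ofReal_div] at hlog
  have hroots : ∀ w ∈ L.roots, w.im = 0 ∧ w.re < 0 := fun w hw =>
    hp.root_neg hx k (Polynomial.isRoot_of_mem_roots hw)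
  have hmain := Multiset.prod_norm_sub_le_exp L.roots hroots ht
  rw [← hlog, Complex.ofReal_re] at hmain
  have hn : ∀ s : ℂ, ‖L.eval s‖ = ‖L.leadingCoeff‖ * ‖(L.roots.map (fun w => s - w)).prod‖ := by
    intro s
    rw [← norm_mul, hsp.eval_eq_prod_roots]
  have h1 := hn t
  have h2 := hn 0
  rw [hLt, Complex.norm_real, Real.norm_of_nonneg hpos'.le] at h1
  rw [hL0, Complex.norm_real, Real.norm_of_nonneg hpos.le] at h2
  rw [h1]
  nth_rw 1 [h2]
  rw [mul_assoc]
  exact mul_le_mul_of_nonneg_left hmain (norm_nonneg _)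

end MvPolynomial

namespace MvPolynomial

variable {σ : Type*}

/-- The capacity induction sets eliminated variables to zero, so the bound is needed on the boundary
of the orthant; it follows by shifting `x` by `s → 0⁺`. -/
theorem PosStable.eval_add_le [DecidableEq σ] {d : ℕ} {p : MvPolynomial σ ℝ}
    (hp : PosStable d p) {x : σ → ℝ} (hx : ∀ i, 0 ≤ x i) {j : σ} (hj : 0 < x j) (k : σ) {t : ℝ}
    (ht : 0 ≤ t) :
    eval (fun i => x i + if i = k then t else 0) p ≤
      eval x p * Real.exp (t * (eval x (MvPolynomial.pderiv k p) / eval x p)) := by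
  have hcont : ∀ (q : MvPolynomial σ ℝ) (y : σ → ℝ),
      Tendsto (fun s : ℝ => eval (fun i => y i + s) q) (𝓝[>] 0) (𝓝 (eval y q)) := by
    intro q y
    have : Continuous fun s : ℝ => eval (fun i => y i + s) q := by
      simp only [eval_eq]; fun_prop
    have h := this.tendsto 0
    simp only [add_zero] at h
    exact h.mono_left nhdsWithin_le_nhds
  have hpos : 0 < eval x p := hp.eval_pos hx hj
  refine le_of_tendsto_of_tendsto (hcont p _) ((hcont p x).mul
    (Real.continuous_exp.continuousAt.tendsto.comp
    (((hcont (MvPolynomial.pderiv k p) x).div (hcont p x) hpos.ne').const_mul t))) ?_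
  filter_upwards [self_mem_nhdsWithin] with s hs
  have hs : 0 < s := hs
  have := hp.eval_add_le_of_pos (x := fun i => x i + s) (fun i => by linarith [hx i]) k ht
  refine le_trans (le_of_eq ?_) this
  congr 2
  ext i
  ring

/-- Gurvits' capacity inequality, with the constant `e` in each step. -/
theorem PosStable.capacity_le_coeff [Fintype σ] [DecidableEq σ] (T : Finset σ) :
    ∀ {p : MvPolynomial σ ℝ}, PosStable T.card p → ∀ {c : ℝ}, 0 ≤ c →
      (∀ x : σ → ℝ, (∀ i ∈ T, 0 < x i) → (∀ i ∉ T, x i = 0) → c * ∏ i ∈ T, x i ≤ eval x p) →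
      c ≤ Real.exp 1 ^ T.card * coeff (∑ i ∈ T, Finsupp.single i 1) p := by
  induction T using Finset.induction_on with
  | empty =>
    intro p hp c _ h
    have := h 0 (by simp) (by simp)
    simpa [constantCoeff_eq] using this
  | insert k T hk ih =>
    intro p hp c hc h
    rw [Finset.card_insert_of_notMem hk] at hp ⊢
    have hq := hp.pderiv k
    have hcoeff : coeff (∑ i ∈ T, Finsupp.single i 1) (MvPolynomial.pderiv k p) =
        coeff (∑ i ∈ insert k T, Finsupp.single i 1) p := by
      rw [coeff_pderiv, Finset.sum_insert hk, add_comm]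
      have : (∑ i ∈ T, Finsupp.single i 1 : σ →₀ ℕ) k = 0 := by
        rw [Finsupp.finsetSum_apply]
        exact Finset.sum_eq_zero fun i hi => by
          rw [Finsupp.single_apply, if_neg]; rintro rfl; exact hk hi
      rw [this]; simp
    -- It suffices that passing from `p` to `∂ₖp` at `x k = 0` loses at most a factor `e` of
    -- capacity.
    have := ih hq (c := c / Real.exp 1) (by positivity) ?_
    · rw [hcoeff, div_le_iff₀ (Real.exp_pos 1)] at this
      rw [pow_succ]; linarith
    intro x hx hx0
    have hx' : ∀ i, 0 ≤ x i := fun i => by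
      by_cases hi : i ∈ T
      · exact (hx i hi).le
      · rw [hx0 i hi]
    have hlow : ∀ t : ℝ, 0 < t → c * (t * ∏ i ∈ T, x i) ≤
        eval (fun i => x i + if i = k then t else 0) p := by
      intro t ht
      have := h (fun i => x i + if i = k then t else 0) ?_ ?_
      · rw [Finset.prod_insert hk] at this
        have hprod : ∏ i ∈ T, (x i + if i = k then t else 0) = ∏ i ∈ T, x i :=
          Finset.prod_congr rfl fun i hi => by
            rw [if_neg (by rintro rfl; exact hk hi), add_zero]
        rw [hprod, hx0 k hk] at this
        simpa using this
      · intro i hi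
        rcases Finset.mem_insert.mp hi with rfl | hi
        · simpa [hx0 i hk] using ht
        · have := hx i hi
          split_ifs <;> linarith
      · intro i hi
        rw [Finset.mem_insert, not_or] at hi
        simp [hx0 i hi.2, hi.1]
    -- For empty `T` the point is `0` and `p` vanishes there, so no division by `p(x)` is possible.
    -- Here `p` has degree one, and Euler's identity identifies `∂ₖp` with `p(e_k)`.
    rcases T.eq_empty_or_nonempty with rfl | ⟨j, hjT⟩
    · have h1 := hlow 1 one_pos
      have h2 : x = 0 := by ext i; exact hx0 i (by simp)
      subst h2
      simp only [Finset.card_empty, zero_add, Finset.prod_empty, mul_one, Pi.zero_apply] at *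
      have heuler := congrArg (eval (fun i => if i = k then (1:ℝ) else 0))
        hp.homogeneous.sum_X_mul_pderiv
      simp only [map_sum, map_mul, eval_X, ite_mul, one_mul, zero_mul, Finset.sum_ite_eq',
        Finset.mem_univ, if_true, one_smul] at heuler
      have hconst := totalDegree_eq_zero_iff_eq_C.mp
        ((totalDegree_zero_iff_isHomogeneous _).mpr hq.homogeneous)
      have h0 : eval 0 (MvPolynomial.pderiv k p) = eval (fun i => if i = k then (1:ℝ) else 0) p := by
        rw [← heuler, hconst]; simp
      rw [h0, div_le_iff₀ (Real.exp_pos 1)]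
      have := Real.add_one_le_exp 1
      nlinarith
    · have hpx : 0 < eval x p := hp.eval_pos hx' (hx j hjT)
      have hqx : 0 < eval x (MvPolynomial.pderiv k p) := hq.eval_pos hx' (hx j hjT)
      set P := eval x p
      set Q := eval x (MvPolynomial.pderiv k p)
      -- The choice `t = P / Q` minimises `exp (t * Q / P) / t`; the exponent becomes `1`.
      have h1 := hlow (P / Q) (by positivity)
      have h2 := hp.eval_add_le hx' (hx j hjT) k (t := P / Q) (by positivity)
      have h3 : P / Q * (Q / P) = 1 := by field_simp
      change _ ≤ P * Real.exp (P / Q * (Q / P)) at h2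
      rw [h3] at h2
      have h4 := h1.trans h2
      rw [div_mul_eq_mul_div, div_le_iff₀ (Real.exp_pos 1)]
      have h5 : c * (P / Q * ∏ i ∈ T, x i) = P * (c * ∏ i ∈ T, x i) / Q := by ring
      rw [h5, div_le_iff₀ hqx, mul_assoc] at h4
      have := le_of_mul_le_mul_left h4 hpx
      linarith

end MvPolynomial

/-! ### Permanents of doubly stochastic matrices -/

open MvPolynomial in
theorem MvPolynomial.PosStable.prod_linear {ι σ : Type*} [Fintype σ] [DecidableEq σ]
    [Nonempty σ] (A : ι → σ → ℝ)
    (hA : ∀ i j, 0 < A i j) (s : Finset ι) :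
    PosStable s.card (∏ i ∈ s, ∑ j, C (A i j) * X j : MvPolynomial σ ℝ) where
  homogeneous := by
    have := IsHomogeneous.prod s (fun i => ∑ j, C (A i j) * X j : ι → MvPolynomial σ ℝ)
      (fun _ => 1) (fun i _ => IsHomogeneous.sum _ _ _ fun j _ => isHomogeneous_C_mul_X _ _)
    simpa using this
  coeff_pos := by
    classical
    induction s using Finset.induction_on with
    | empty =>
      intro m hm
      have : m = 0 := (Finsupp.degree_eq_zero_iff m).mp (by simpa using hm)
      subst this
      simp
    | insert i s hi ih =>
      intro m hm
      rw [Finset.card_insert_of_notMem hi] at hm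
      rw [Finset.prod_insert hi, Finset.sum_mul, coeff_sum]
      have hnn : ∀ m' : σ →₀ ℕ, 0 ≤ coeff m' (∏ i ∈ s, ∑ j, C (A i j) * X j : MvPolynomial σ ℝ) := by
        intro m'
        by_cases h : m'.degree = s.card
        · exact (ih m' h).le
        · have := IsHomogeneous.prod s (fun i => ∑ j, C (A i j) * X j : ι → MvPolynomial σ ℝ)
            (fun _ => 1) (fun i _ => IsHomogeneous.sum _ _ _ fun j _ => isHomogeneous_C_mul_X _ _)
          rw [this.coeff_eq_zero (by simpa using h)]
      obtain ⟨k, hk⟩ : ∃ k, k ∈ m.support := by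
        by_contra! h
        have : m = 0 := by
          ext k; simpa using h k
        subst this
        simp at hm
      simp only [mul_assoc, coeff_C_mul, coeff_X_mul']
      refine Finset.sum_pos' (fun j _ => ?_) ⟨k, Finset.mem_univ _, ?_⟩
      · split_ifs
        · exact mul_nonneg (hA i j).le (hnn _)
        · simp
      · rw [if_pos hk]
        refine mul_pos (hA i k) (ih _ ?_)
        have hle : Finsupp.single k 1 ≤ m := by
          rw [Finsupp.single_le_iff]
          exact Nat.one_le_iff_ne_zero.mpr (Finsupp.mem_support_iff.mp hk)
        have := congrArg Finsupp.degree (tsub_add_cancel_of_le hle)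
        rw [map_add, Finsupp.degree_single] at this
        omega
  stable z hz := by
    rw [map_prod, Finset.prod_ne_zero_iff]
    intro i _ h0
    have := congrArg Complex.re h0
    simp only [map_sum, map_mul, aeval_X, aeval_C, Complex.re_sum, Complex.coe_algebraMap,
      Complex.re_ofReal_mul, Complex.zero_re] at this
    have hpos : 0 < ∑ j, A i j * (z j).re :=
      Finset.sum_pos (fun j _ => mul_pos (hA i j) (hz j)) Finset.univ_nonempty
    linarith

open MvPolynomial in
theorem MvPolynomial.coeff_prod_linear_eq_permanent {n : Type*} [Fintype n] [DecidableEq n]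
    (A : Matrix n n ℝ) :
    coeff (∑ i, Finsupp.single i 1) (∏ i, ∑ j, C (A i j) * X j : MvPolynomial n ℝ)
      = A.permanent := by
  rw [Finset.prod_univ_sum, coeff_sum, Fintype.piFinset_univ, ← Matrix.permanent_transpose,
    Matrix.permanent]
  have hterm : ∀ f : n → n, coeff (∑ i, Finsupp.single i 1)
      (∏ i, (C (A i (f i)) * X (f i)) : MvPolynomial n ℝ) =
      if Function.Bijective f then ∏ i, A i (f i) else 0 := by
    intro f
    have : (∏ i, (C (A i (f i)) * X (f i)) : MvPolynomial n ℝ) =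
        monomial (∑ i, Finsupp.single (f i) 1) (∏ i, A i (f i)) := by
      rw [monomial_sum_index, Finset.prod_mul_distrib, map_prod]
      rfl
    rw [this, coeff_monomial]
    refine if_congr ⟨fun h => ?_, fun h => ?_⟩ rfl rfl
    · refine Finite.injective_iff_bijective.mp (Finite.injective_iff_surjective.mpr fun j => ?_)
      by_contra! hj
      have := DFunLike.congr_fun h j
      simp [Finsupp.finsetSum_apply, Finsupp.single_apply, hj] at this
    · exact Function.Bijective.sum_comp h (fun i => Finsupp.single i 1)
  rw [Finset.sum_congr rfl fun f _ => hterm f, ← Finset.sum_filter]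
  refine (Finset.sum_bij (fun (τ : Equiv.Perm n) _ => (τ : n → n))
    (fun τ _ => by simp) (fun σ _ τ _ h => DFunLike.coe_injective h)
    (fun f hf => ⟨Equiv.ofBijective f (by simpa using hf), Finset.mem_univ _, rfl⟩)
    (fun τ _ => rfl)).symm

/-- Column sums split each `x j` into powers `x j ^ A i j`; weighted AM–GM is then applied in each
row. This says that the capacity of the product of the row forms is at least `1`. -/
theorem Real.prod_le_prod_sum_of_doublyStochastic {n : Type*} [Fintype n] (A : Matrix n n ℝ)
    (hA : ∀ i j, 0 ≤ A i j) (hr : ∀ i, ∑ j, A i j = 1) (hc : ∀ j, ∑ i, A i j = 1) (x : n → ℝ)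
    (hx : ∀ i, 0 < x i) : ∏ j, x j ≤ ∏ i, ∑ j, A i j * x j := by
  calc ∏ j, x j = ∏ j, ∏ i, x j ^ A i j := by
        refine Finset.prod_congr rfl fun j _ => ?_
        rw [← Real.rpow_sum_of_pos (hx j), hc, Real.rpow_one]
    _ = ∏ i, ∏ j, x j ^ A i j := Finset.prod_comm
    _ ≤ _ := Finset.prod_le_prod
        (fun i _ => Finset.prod_nonneg fun j _ => Real.rpow_nonneg (hx j).le _)
        fun i _ => Real.geom_mean_le_arith_mean_weighted _ _ _ (fun j _ => hA i j) (hr i)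
          fun j _ => (hx j).le

theorem Matrix.one_le_exp_pow_mul_permanent_of_pos {n : Type*} [Fintype n] [DecidableEq n]
    (A : Matrix n n ℝ) (hA : ∀ i j, 0 < A i j) (hr : ∀ i, ∑ j, A i j = 1)
    (hc : ∀ j, ∑ i, A i j = 1) : 1 ≤ Real.exp 1 ^ Fintype.card n * A.permanent := by
  cases isEmpty_or_nonempty n
  · simp [Matrix.permanent_isEmpty]
  have := MvPolynomial.PosStable.capacity_le_coeff Finset.univ
    (MvPolynomial.PosStable.prod_linear A hA Finset.univ) (c := 1) zero_le_one ?_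
  · rwa [MvPolynomial.coeff_prod_linear_eq_permanent] at this
  · intro x hx _
    simpa [MvPolynomial.eval_prod] using Real.prod_le_prod_sum_of_doublyStochastic A
      (fun i j => (hA i j).le) hr hc x fun i => hx i (Finset.mem_univ i)

/-- A weak form of van der Waerden's conjecture. -/
theorem Matrix.one_le_exp_pow_mul_permanent {n : Type*} [Fintype n] [DecidableEq n]
    (A : Matrix n n ℝ) (hA : ∀ i j, 0 ≤ A i j) (hr : ∀ i, ∑ j, A i j = 1)
    (hc : ∀ j, ∑ i, A i j = 1) : 1 ≤ Real.exp 1 ^ Fintype.card n * A.permanent := by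
  cases isEmpty_or_nonempty n
  · simp [Matrix.permanent_isEmpty]
  set N : ℝ := (Fintype.card n : ℝ) with hN
  have hNpos : 0 < N := by rw [hN]; exact_mod_cast Fintype.card_pos
  -- Mixing with the uniform matrix keeps double stochasticity and makes all entries positive; then
  -- `t → 0⁺`.
  let B : ℝ → Matrix n n ℝ := fun t => .of fun i j => (1 - t) * A i j + t * N⁻¹
  have hcont : Continuous fun t => Real.exp 1 ^ Fintype.card n * (B t).permanent := by
    simp only [B, Matrix.permanent, Matrix.of_apply]
    fun_prop
  have hB0 : B 0 = A := by ext i j; simp [B]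
  have hlim := (hcont.tendsto 0).mono_left (nhdsWithin_le_nhds (s := Set.Ioi 0))
  simp only [hB0] at hlim
  refine ge_of_tendsto hlim ?_
  filter_upwards [Ioo_mem_nhdsGT (show (0:ℝ) < 1 by norm_num)] with t ht
  have hconst : ∑ _i : n, t * N⁻¹ = t := by
    rw [Finset.sum_const, Finset.card_univ, nsmul_eq_mul, ← hN]; field_simp
  refine (B t).one_le_exp_pow_mul_permanent_of_pos (fun i j => ?_) (fun i => ?_) fun j => ?_
  · have h1 := ht.1
    have h2 := ht.2
    have : 0 ≤ (1 - t) * A i j := mul_nonneg (by linarith) (hA i j)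
    have : 0 < t * N⁻¹ := by positivity
    simp only [B, Matrix.of_apply]; linarith
  · simp only [B, Matrix.of_apply]
    rw [Finset.sum_add_distrib, ← Finset.mul_sum, hr, hconst]; ring
  · simp only [B, Matrix.of_apply]
    rw [Finset.sum_add_distrib, ← Finset.mul_sum, hc, hconst]; ring

/-- Equalizing the row sums of a matrix by a perturbation supported on a dense pattern `a`,
keeping the column sums. -/
theorem Matrix.exists_equal_row_sums {n : Type*} [Fintype n] [Nonempty n] (a B : Matrix n n ℝ)
    (ha : ∀ i j, a i j = 0 ∨ a i j = 1) {K D : ℝ} (hK : 0 < K)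
    (hcodeg : ∀ i i', K ≤ ∑ j, a i j * a i' j)
    (hD : ∀ i i', |∑ j, B i j - ∑ j, B i' j| ≤ D) :
    ∃ B' : Matrix n n ℝ, (∀ i, ∑ j, B' i j = (∑ i', ∑ j, B i' j) / Fintype.card n) ∧
      (∀ j, ∑ i, B' i j = ∑ i, B i j) ∧ (∀ i j, a i j = 0 → B' i j = B i j) ∧
      ∀ i j, |B' i j - B i j| ≤ D / K := by
  set N : ℝ := (Fintype.card n : ℝ) with hN
  have hNpos : 0 < N := by rw [hN]; exact_mod_cast Fintype.card_pos
  set r : n → ℝ := fun i => ∑ j, B i j with hr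
  set q : n → n → ℝ := fun i i' => ∑ j, a i j * a i' j with hq
  have hqpos : ∀ i i', 0 < q i i' := fun i i' => hK.trans_le (hcodeg i i')
  set T : n → n → n → ℝ := fun i i' j => (r i - r i') / N * (a i j * a i' j) / q i i' with hT
  have hanti : ∀ i i' j, T i i' j = - T i' i j := by
    intro i i' j
    have : q i i' = q i' i := by simp only [hq, mul_comm]
    simp only [hT, this]
    ring
  refine ⟨.of fun i j => B i j - ∑ i', T i i' j, fun i => ?_, fun j => ?_, fun i j h0 => ?_,
    fun i j => ?_⟩
  · simp only [Matrix.of_apply, Finset.sum_sub_distrib]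
    rw [Finset.sum_comm]
    have : ∀ i', ∑ j, T i i' j = (r i - r i') / N := by
      intro i'
      simp only [hT]
      rw [← Finset.sum_div, ← Finset.mul_sum]
      exact mul_div_cancel_right₀ _ (hqpos i i').ne'
    rw [Finset.sum_congr rfl fun i' _ => this i', ← Finset.sum_div, Finset.sum_sub_distrib,
      Finset.sum_const, Finset.card_univ, nsmul_eq_mul, ← hN]
    change r i - _ = (∑ i', r i') / N
    field_simp
    ring
  · simp only [Matrix.of_apply, Finset.sum_sub_distrib]
    have : ∑ i, ∑ i', T i i' j = - ∑ i, ∑ i', T i i' j := by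
      conv_lhs => rw [Finset.sum_comm]
      rw [← Finset.sum_neg_distrib]
      refine Finset.sum_congr rfl fun i _ => ?_
      rw [← Finset.sum_neg_distrib]
      exact Finset.sum_congr rfl fun i' _ => hanti _ _ _
    linarith
  · simp [hT, h0]
  · have hle : ∀ i', |T i i' j| ≤ D / K / N := by
      intro i'
      have h1 : |a i j * a i' j| ≤ 1 := by
        rcases ha i j with h | h <;> rcases ha i' j with h' | h' <;> simp [h, h']
      simp only [hT]
      rw [abs_div, abs_mul, abs_div, abs_of_pos hNpos, abs_of_pos (hqpos i i')]
      have hD0 : 0 ≤ D := (abs_nonneg _).trans (hD i i')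
      calc |r i - r i'| / N * |a i j * a i' j| / q i i' ≤ D / N * 1 / K := by
            gcongr
            · exact hD i i'
            · exact hcodeg i i'
        _ = _ := by field_simp
    simp only [Matrix.of_apply, sub_sub_cancel_left, abs_neg]
    calc |∑ i', T i i' j| ≤ ∑ i', |T i i' j| := Finset.abs_sum_le_sum_abs _ _
      _ ≤ ∑ _i' : n, D / K / N := Finset.sum_le_sum fun i' _ => hle i'
      _ = D / K := by
        rw [Finset.sum_const, Finset.card_univ, nsmul_eq_mul, ← hN]; field_simp

/-! ### Many permutations along the edges -/

namespace SimpleGraph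

variable {V : Type*} [Fintype V] [DecidableEq V] (G : SimpleGraph V) [DecidableRel G.Adj]

/-- The permutations that move every vertex to a neighbour. -/
def adjPerms : Finset (Equiv.Perm V) := {σ | ∀ v, G.Adj v (σ v)}

variable {G} in
theorem mem_adjPerms {σ : Equiv.Perm V} : σ ∈ G.adjPerms ↔ ∀ v, G.Adj v (σ v) := by
  simp [adjPerms]

theorem sum_adjMatrix_mul_adjMatrix (u v : V) :
    ∑ w, (G.adjMatrix ℝ u w) * (G.adjMatrix ℝ v w) =
      ((G.neighborFinset u ∩ G.neighborFinset v).card : ℝ) := by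
  simp only [adjMatrix_apply, ← ite_and, mul_ite, mul_one, mul_zero]
  rw [Finset.sum_boole]
  congr 2
  ext w; simp [and_comm]

theorem two_mul_le_card_add_card_inter {x : ℝ} (hx : ∀ v, x ≤ G.degree v) (u v : V) :
    2 * x ≤ Fintype.card V + ((G.neighborFinset u ∩ G.neighborFinset v).card : ℝ) := by
  have h1 := Finset.card_union_add_card_inter (G.neighborFinset u) (G.neighborFinset v)
  have h2 := Finset.card_le_univ (G.neighborFinset u ∪ G.neighborFinset v)
  rw [G.card_neighborFinset_eq_degree, G.card_neighborFinset_eq_degree] at h1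
  have h3 : (G.degree u : ℝ) + G.degree v ≤
      Fintype.card V + ((G.neighborFinset u ∩ G.neighborFinset v).card : ℝ) := by
    exact_mod_cast (by omega)
  linarith [hx u, hx v]

/-- The equalisation is used twice: on the adjacency matrix, then on the transpose of the result,
where it keeps the sums already made equal. The final matrix is `s` times a doubly stochastic one,
with `s ≥ x` the average degree. It is supported on edges with entries at most `1 + 2 * (y - x) /
K`, so its permanent compares with the count. -/
theorem pow_le_mul_card_adjPerms [Nonempty V] {x y K : ℝ} (hx0 : 0 < x)
    (hx : ∀ v, x ≤ G.degree v) (hy : ∀ v, G.degree v ≤ y) (hK : 0 < K)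
    (hxK : Fintype.card V + K ≤ 2 * x) (hxy : 2 * (y - x) ≤ K) :
    x ^ Fintype.card V ≤
      (Real.exp 1 * (1 + 2 * (y - x) / K)) ^ Fintype.card V * G.adjPerms.card := by
  set a := G.adjMatrix ℝ with ha
  have ha01 : ∀ i j, a i j = 0 ∨ a i j = 1 := by
    intro i j; simp only [ha, adjMatrix_apply]; split_ifs <;> simp
  have hasymm : ∀ i j, a i j = a j i := by
    intro i j; simp only [ha, adjMatrix_apply, G.adj_comm]
  have hrow : ∀ i, ∑ j, a i j = G.degree i := fun i => by
    simp only [ha, adjMatrix_apply, Finset.sum_boole]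
    rw [← G.card_neighborFinset_eq_degree]
    congr 2
    ext w; simp
  have hcol : ∀ j, ∑ i, a i j = G.degree j := fun j => by
    rw [← hrow j]; exact Finset.sum_congr rfl fun i _ => hasymm _ _
  have hcodeg : ∀ u v, K ≤ ∑ w, a u w * a v w := by
    intro u v
    rw [ha, G.sum_adjMatrix_mul_adjMatrix]
    linarith [G.two_mul_le_card_add_card_inter hx u v]
  have hD : ∀ u v, |(G.degree u : ℝ) - G.degree v| ≤ y - x := by
    intro u v
    rw [abs_le]
    constructor <;> linarith [hx u, hx v, hy u, hy v]
  obtain ⟨B, hB1, hB2, hB3, hB4⟩ := Matrix.exists_equal_row_sums a a ha01 hK hcodeg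
    (D := y - x) (by simpa only [hrow] using hD)
  obtain ⟨C, hC1, hC2, hC3, hC4⟩ := Matrix.exists_equal_row_sums a B.transpose ha01 hK hcodeg
    (D := y - x) (by simpa only [Matrix.transpose_apply, hB2, hcol] using hD)
  simp only [Matrix.transpose_apply, hB1, hB2, hrow, hcol] at hC1 hC2 hC3 hC4
  set s : ℝ := (∑ i, (G.degree i : ℝ)) / Fintype.card V with hs
  have hN : (0 : ℝ) < Fintype.card V := by exact_mod_cast Fintype.card_pos
  have hxs : x ≤ s := by
    rw [hs, le_div_iff₀ hN, mul_comm]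
    calc (Fintype.card V : ℝ) * x = ∑ _i : V, x := by
          rw [Finset.sum_const, Finset.card_univ, nsmul_eq_mul]
      _ ≤ _ := Finset.sum_le_sum fun i _ => hx i
  have hspos : 0 < s := hx0.trans_le hxs
  set β := (y - x) / K with hβ
  have hβ1 : 2 * β ≤ 1 := by
    rw [hβ, ← mul_div_assoc, div_le_one hK]; exact hxy
  have hβ0 : 0 ≤ β := (abs_nonneg _).trans (hB4 (Classical.arbitrary V) (Classical.arbitrary V))
  have hC0 : ∀ i j, 0 ≤ C i j ∧ C i j ≤ (1 + 2 * β) * a i j := by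
    intro i j
    have hsym : a j i = a i j := hasymm j i
    rcases ha01 i j with h | h
    · rw [hC3 i j h, hB3 j i (by rw [hsym, h]), hsym, h]; simp
    · have h1 := abs_le.mp (hB4 j i)
      have h2 := abs_le.mp (hC4 i j)
      rw [hsym, h] at h1
      rw [h]
      constructor <;> linarith
  have hvdw := Matrix.one_le_exp_pow_mul_permanent (n := V) (s⁻¹ • C)
    (fun i j => by
      rw [Matrix.smul_apply, smul_eq_mul]; exact mul_nonneg (by positivity) (hC0 i j).1)
    (fun i => by
      simp only [Matrix.smul_apply, smul_eq_mul, ← Finset.mul_sum, hC1]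
      exact inv_mul_cancel₀ hspos.ne')
    (fun j => by
      simp only [Matrix.smul_apply, smul_eq_mul, ← Finset.mul_sum, hC2]
      exact inv_mul_cancel₀ hspos.ne')
  rw [Matrix.permanent_smul, inv_pow] at hvdw
  have hper : C.permanent ≤ (1 + 2 * β) ^ Fintype.card V * G.adjPerms.card := by
    have h1 : ∀ σ : Equiv.Perm V, ∏ i, C (σ i) i ≤
        if σ ∈ G.adjPerms then (1 + 2 * β) ^ Fintype.card V else 0 := by
      intro σ
      calc ∏ i, C (σ i) i ≤ ∏ i, ((1 + 2 * β) * a (σ i) i) :=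
            Finset.prod_le_prod (fun i _ => (hC0 _ _).1) fun i _ => (hC0 _ _).2
        _ = (1 + 2 * β) ^ Fintype.card V * ∏ i, a (σ i) i := by
            rw [Finset.prod_mul_distrib, Finset.prod_const, Finset.card_univ]
        _ = _ := by
            split_ifs with h
            · rw [Finset.prod_eq_one, mul_one]
              intro i _
              simp [ha, adjMatrix_apply, (mem_adjPerms.mp h i).symm]
            · rw [mem_adjPerms] at h
              push Not at h
              obtain ⟨v, hv⟩ := h
              rw [Finset.prod_eq_zero (Finset.mem_univ v), mul_zero]
              simp [ha, adjMatrix_apply, G.adj_comm (σ v) v, hv]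
    calc C.permanent ≤ ∑ σ : Equiv.Perm V,
          if σ ∈ G.adjPerms then (1 + 2 * β) ^ Fintype.card V else 0 :=
          Finset.sum_le_sum fun σ _ => h1 σ
      _ = _ := by
        rw [Finset.sum_ite_mem, Finset.univ_inter, Finset.sum_const, nsmul_eq_mul, mul_comm]
  rw [← mul_assoc, mul_comm (Real.exp 1 ^ _), mul_assoc, ← div_eq_inv_mul,
    one_le_div (by positivity)] at hvdw
  calc x ^ Fintype.card V ≤ s ^ Fintype.card V := by gcongr
    _ ≤ _ := hvdw
    _ ≤ Real.exp 1 ^ Fintype.card V * ((1 + 2 * β) ^ Fintype.card V * G.adjPerms.card) := by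
      gcongr
    _ = _ := by rw [mul_pow, mul_assoc, hβ, mul_div_assoc]

end SimpleGraph

/-! ### Permutations with many cycles -/

namespace Equiv.Perm

variable {V : Type*}

/-- The number of cycles of a permutation, fixed points included. -/
noncomputable def numCycles (σ : Perm V) : ℕ := Nat.card (Quotient (SameCycle.setoid σ))

theorem exists_comp_eq_of_map_univ_eq [Fintype V] {α : Type*} [DecidableEq α] {f g : V → α}
    (h : Finset.univ.val.map f = Finset.univ.val.map g) : ∃ e : Perm V, ∀ v, g (e v) = f v := by
  classical
  have hcard : ∀ i, Fintype.card {x // f x = i} = Fintype.card {x // g x = i} := by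
    intro i
    have := congrArg (Multiset.count i) h
    rw [Multiset.count_map, Multiset.count_map] at this
    rw [Fintype.card_subtype, Fintype.card_subtype, Finset.card_def, Finset.card_def,
      Finset.filter_val, Finset.filter_val]
    simpa only [eq_comm] using this
  let e : ∀ i, {x // f x = i} ≃ {x // g x = i} := fun i => Fintype.equivOfCardEq (hcard i)
  refine ⟨((Equiv.sigmaFiberEquiv f).symm.trans (Equiv.sigmaCongrRight e)).trans
    (Equiv.sigmaFiberEquiv g), fun v => ?_⟩
  exact (e (f v) ⟨v, rfl⟩).2

attribute [local instance] arrowAction in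
/-- Colourings constant on the cycles of permutations, counted by Burnside's lemma. -/
theorem sum_pow_numCycles_le [Fintype V] [DecidableEq V] (N : ℕ) :
    ∑ σ : Perm V, N ^ σ.numCycles ≤
      Nat.multichoose N (Fintype.card V) * (Fintype.card V).factorial := by
  classical
  have hfix : ∀ σ : Perm V, N ^ σ.numCycles ≤
      Fintype.card (MulAction.fixedBy (V → Fin N) σ) := by
    intro σ
    rw [numCycles, Nat.card_eq_fintype_card]
    calc N ^ Fintype.card (Quotient (SameCycle.setoid σ))
        = Fintype.card (Quotient (SameCycle.setoid σ) → Fin N) := by simp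
      _ ≤ _ := by
        have hmem : ∀ F : Quotient (SameCycle.setoid σ) → Fin N,
            (fun v => F (Quotient.mk _ v)) ∈ MulAction.fixedBy (V → Fin N) σ := by
          intro F
          rw [MulAction.mem_fixedBy]
          funext v
          change F (Quotient.mk _ (σ⁻¹ v)) = F (Quotient.mk _ v)
          congr 1
          exact Quotient.sound (s := SameCycle.setoid σ) ⟨1, by simp⟩
        refine Fintype.card_le_of_injective (fun F => ⟨_, hmem F⟩) fun F F' h => ?_
        funext q
        induction q using Quotient.inductionOn with
        | h v => exact congrFun (congrArg Subtype.val h) v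
  -- An orbit of colourings is determined by its multiset of colours.
  have horb : Fintype.card (Quotient (MulAction.orbitRel (Perm V) (V → Fin N))) ≤
      Nat.multichoose N (Fintype.card V) := by
    calc _ ≤ Fintype.card (Sym (Fin N) (Fintype.card V)) := by
          refine Fintype.card_le_of_injective (Quotient.lift
            (fun f => (⟨Finset.univ.val.map f, by simp⟩ : Sym (Fin N) (Fintype.card V))) ?_) ?_
          · rintro f g ⟨σ, rfl⟩
            refine Subtype.ext ?_
            change Finset.univ.val.map (fun v => g (σ⁻¹ v)) = _
            change _ = Finset.univ.val.map g
            conv_rhs => rw [← Multiset.map_univ_val_equiv σ⁻¹, Multiset.map_map]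
            rfl
          · intro q q' h
            induction q, q' using Quotient.inductionOn₂ with
            | h f g =>
              obtain ⟨e, he⟩ := exists_comp_eq_of_map_univ_eq (Subtype.ext_iff.mp h)
              refine Quotient.sound ⟨e⁻¹, ?_⟩
              funext v
              exact he v
      _ = _ := by rw [Sym.card_sym_eq_multichoose, Fintype.card_fin]
  calc ∑ σ : Perm V, N ^ σ.numCycles
      ≤ ∑ σ : Perm V, Fintype.card (MulAction.fixedBy (V → Fin N) σ) :=
        Finset.sum_le_sum fun σ _ => hfix σ
    _ = _ := MulAction.sum_card_fixedBy_eq_card_orbits_mul_card_group (Perm V) (V → Fin N)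
    _ ≤ _ := by
      rw [Fintype.card_perm]
      exact Nat.mul_le_mul_right _ horb

/-- Markov's inequality for `n ^ numCycles`, with as many colours as points. -/
theorem card_numCycles_ge_mul_pow_le [Fintype V] [DecidableEq V] [Nonempty V] (k : ℕ) :
    ({σ : Perm V | k ≤ σ.numCycles} : Finset (Perm V)).card * Fintype.card V ^ k ≤
      4 ^ Fintype.card V * (Fintype.card V).factorial := by
  set n := Fintype.card V with hn
  have hn1 : 1 ≤ n := Fintype.card_pos
  calc ({σ : Perm V | k ≤ σ.numCycles} : Finset (Perm V)).card * n ^ k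
      = ∑ σ : Perm V with k ≤ σ.numCycles, n ^ k := by rw [Finset.sum_const, smul_eq_mul]
    _ ≤ ∑ σ : Perm V with k ≤ σ.numCycles, n ^ σ.numCycles :=
        Finset.sum_le_sum fun σ hσ => Nat.pow_le_pow_right hn1 (by simpa using hσ)
    _ ≤ ∑ σ : Perm V, n ^ σ.numCycles :=
        Finset.sum_le_sum_of_subset (Finset.filter_subset _ _)
    _ ≤ _ := sum_pow_numCycles_le n
    _ ≤ _ := by
        refine Nat.mul_le_mul_right _ ?_
        rw [Nat.multichoose_eq]
        calc (n + n - 1).choose n ≤ 2 ^ (n + n - 1) := Nat.choose_le_two_pow _ _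
          _ ≤ 2 ^ (2 * n) := Nat.pow_le_pow_right (by norm_num) (by omega)
          _ = 4 ^ n := by rw [pow_mul]; norm_num


/-- By finiteness `y` is a nonnegative power of `σ` applied to `x`, so forward closure of `T` is
enough. The comparisons of cycles below are instances with suitable `T`. -/
theorem SameCycle.mem_of_forall_mem [Finite V] {σ : Perm V} {x y : V} (h : σ.SameCycle x y)
    {T : Set V} (hT : ∀ a ∈ T, σ a ∈ T) (hx : x ∈ T) : y ∈ T := by
  obtain ⟨i, rfl⟩ := h.exists_nat_pow_eq
  clear h
  induction i with
  | zero => simpa using hx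
  | succ i ih => rw [pow_succ', mul_apply]; exact hT _ ih

/-! ### How transpositions merge and split cycles -/

section Swap

variable [DecidableEq V] {σ : Perm V} {u v x y : V}

theorem mul_swap_apply_of_ne (hu : x ≠ u) (hv : x ≠ v) : (σ * swap u v) x = σ x := by
  rw [mul_apply, swap_apply_of_ne_of_ne hu hv]

variable [Finite V]

theorem sameCycle_mul_swap (h : ¬ σ.SameCycle u v) : (σ * swap u v).SameCycle u v := by
  by_contra hcon
  have hmem : u ∈ {z | σ.SameCycle u z ∧ ¬ (σ * swap u v).SameCycle u z} := by
    refine SameCycle.mem_of_forall_mem (σ := σ) (x := σ u) (sameCycle_apply_left.mpr (.refl _ _))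
      ?_ ⟨sameCycle_apply_right.mpr (.refl _ _), ?_⟩
    · rintro z ⟨hz, hz'⟩
      have hzu : z ≠ u := by rintro rfl; exact hz' (.refl _ _)
      have hzv : z ≠ v := by rintro rfl; exact h hz
      refine ⟨sameCycle_apply_right.mpr hz, ?_⟩
      rw [← mul_swap_apply_of_ne (σ := σ) hzu hzv]
      exact fun h' => hz' (sameCycle_apply_right.mp h')
    · have : σ u = (σ * swap u v) v := by simp
      rw [this]
      exact fun h' => hcon (sameCycle_apply_right.mp h')
  exact hmem.2 (.refl _ _)

theorem SameCycle.mul_swap (h : ¬ σ.SameCycle u v) (hxy : σ.SameCycle x y) :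
    (σ * swap u v).SameCycle x y := by
  refine SameCycle.mem_of_forall_mem hxy (T := {z | (σ * swap u v).SameCycle x z}) ?_ (.refl _ _)
  intro z hz
  have huv := sameCycle_mul_swap h
  simp only [Set.mem_ofPred_eq] at hz ⊢
  by_cases hzu : z = u
  · subst hzu
    have : σ z = (σ * swap z v) v := by simp
    rw [this]
    exact sameCycle_apply_right.mpr (hz.trans huv)
  by_cases hzv : z = v
  · subst hzv
    have : σ z = (σ * swap u z) u := by simp
    rw [this]
    exact sameCycle_apply_right.mpr (hz.trans huv.symm)
  · rw [← mul_swap_apply_of_ne (σ := σ) hzu hzv]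
    exact sameCycle_apply_right.mpr hz

theorem SameCycle.of_mul_swap (h : ¬ σ.SameCycle u v) (hx : ¬ σ.SameCycle u x)
    (hy : ¬ σ.SameCycle u y) (hxy : (σ * swap u v).SameCycle x y) : σ.SameCycle x y := by
  -- If `x` shares a cycle with `v`, the merged cycle makes a detour through the old cycle of `u`,
  -- which `T` must include.
  have hmem := SameCycle.mem_of_forall_mem hxy
    (T := {z | σ.SameCycle x z ∨ (σ.SameCycle x v ∧ σ.SameCycle u z)}) ?_ (.inl (.refl _ _))
  · rcases hmem with h1 | h1
    · exact h1
    · exact absurd h1.2 hy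
  rintro z (hz | ⟨hz1, hz2⟩)
  · have hzu : z ≠ u := by rintro rfl; exact hx hz.symm
    by_cases hzv : z = v
    · subst hzv
      right
      simp [hz, SameCycle.refl]
    · left
      rw [mul_swap_apply_of_ne hzu hzv]
      exact sameCycle_apply_right.mpr hz
  · have hzv : z ≠ v := by rintro rfl; exact h hz2
    by_cases hzu : z = u
    · subst hzu
      left
      simp [hz1]
    · right
      rw [mul_swap_apply_of_ne hzu hzv]
      exact ⟨hz1, sameCycle_apply_right.mpr hz2⟩

/-- Multiplying by a transposition merges two cycles. -/
theorem numCycles_mul_swap_lt (h : ¬ σ.SameCycle u v) :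
    (σ * swap u v).numCycles < σ.numCycles := by
  classical
  have := Fintype.ofFinite V
  rw [numCycles, numCycles, Nat.card_eq_fintype_card, Nat.card_eq_fintype_card]
  refine Fintype.card_lt_of_surjective_not_injective
    (Quotient.map' (s₁ := SameCycle.setoid σ) (s₂ := SameCycle.setoid (σ * swap u v)) id
      fun x y hxy => SameCycle.mul_swap h hxy) ?_ ?_
  · intro q
    induction q using Quotient.inductionOn with
    | h a => exact ⟨Quotient.mk _ a, rfl⟩
  · intro hinj
    have h1 : (Quotient.mk (SameCycle.setoid σ) u) = Quotient.mk (SameCycle.setoid σ) v :=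
      hinj (Quotient.sound (s := SameCycle.setoid (σ * swap u v)) (sameCycle_mul_swap h))
    exact h (Quotient.exact h1)

theorem numCycles_le_numCycles_mul_swap_add_one (h : ¬ σ.SameCycle u v) :
    σ.numCycles ≤ (σ * swap u v).numCycles + 1 := by
  classical
  have := Fintype.ofFinite V
  rw [numCycles, numCycles, Nat.card_eq_fintype_card, Nat.card_eq_fintype_card,
    ← Fintype.card_option]
  let F : Quotient (SameCycle.setoid σ) → Option (Quotient (SameCycle.setoid (σ * swap u v))) :=
    fun q => if q = Quotient.mk _ u then none else some (Quotient.mk _ q.out)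
  refine Fintype.card_le_of_injective F ?_
  intro q q' hqq
  by_cases hq : q = Quotient.mk _ u <;> by_cases hq' : q' = Quotient.mk _ u
  · rw [hq, hq']
  · simp [F, hq, hq'] at hqq
  · simp [F, hq, hq'] at hqq
  · simp only [F, hq, hq', if_false, Option.some.injEq] at hqq
    rw [← Quotient.out_eq q, ← Quotient.out_eq q']
    refine Quotient.sound (SameCycle.of_mul_swap h (fun hc => hq ?_) (fun hc => hq' ?_)
      (Quotient.exact hqq))
    · rw [← Quotient.out_eq q]
      exact Quotient.sound hc.symm
    · rw [← Quotient.out_eq q']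
      exact Quotient.sound hc.symm

/-- Multiplying by a transposition splits a cycle. -/
theorem not_sameCycle_mul_swap (huv : u ≠ v) (h : σ.SameCycle v u) :
    ¬ (σ * swap u v).SameCycle u v := by
  intro hcon
  have hex := h.exists_nat_pow_eq
  set a := Nat.find hex with ha
  have hau : (σ ^ a) v = u := Nat.find_spec hex
  have hmin : ∀ i < a, (σ ^ i) v ≠ u := fun i hi => Nat.find_min hex hi
  have ha1 : 1 ≤ a := by
    by_contra h0
    have : a = 0 := by omega
    rw [this] at hau
    exact huv hau.symm
  have hper : ∀ i, 1 ≤ i → i ≤ a → (σ ^ i) v ≠ v := by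
    intro i hi hia hv
    refine hmin (a - i) (by omega) ?_
    rw [← hau]
    conv_rhs => rw [show a = (a - i) + i by omega, pow_add, mul_apply, hv]
  -- The points `σ v, …, σ^a v = u` are closed under `σ * swap u v`, which sends `u` to `σ v`; by
  -- minimality of `a` they avoid `v`.
  have hmem := SameCycle.mem_of_forall_mem hcon
    (T := {z | ∃ i, 1 ≤ i ∧ i ≤ a ∧ (σ ^ i) v = z}) ?_ ⟨a, ha1, le_rfl, hau⟩
  · obtain ⟨i, hi, hia, hiv⟩ := hmem
    exact hper i hi hia hiv
  · rintro z ⟨i, hi, hia, rfl⟩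
    rcases hia.lt_or_eq with hlt | rfl
    · refine ⟨i + 1, by omega, by omega, ?_⟩
      rw [mul_swap_apply_of_ne (hmin i hlt) (hper i hi hia), pow_succ', mul_apply]
    · refine ⟨1, le_rfl, ha1, ?_⟩
      rw [hau]; simp

theorem numCycles_mul_swap_le_of_sameCycle (huv : u ≠ v) (h : σ.SameCycle v u) :
    (σ * swap u v).numCycles ≤ σ.numCycles + 1 := by
  have := numCycles_le_numCycles_mul_swap_add_one (not_sameCycle_mul_swap huv h)
  rwa [mul_assoc, swap_mul_self, mul_one] at this

end Swap

open Classical in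
/-- Reversing the direction of the cycle through `w`. -/
noncomputable def revCycle (σ : Perm V) (w : V) : Perm V where
  toFun a := if σ.SameCycle w a then σ⁻¹ a else σ a
  invFun a := if σ.SameCycle w a then σ a else σ⁻¹ a
  left_inv a := by by_cases h : σ.SameCycle w a <;> simp [h]
  right_inv a := by by_cases h : σ.SameCycle w a <;> simp [h]

section RevCycle

variable {σ : Perm V} {w x y : V}

theorem revCycle_apply_of_sameCycle (h : σ.SameCycle w x) : σ.revCycle w x = σ⁻¹ x := if_pos h

theorem revCycle_apply_of_not_sameCycle (h : ¬ σ.SameCycle w x) : σ.revCycle w x = σ x := if_neg h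

theorem sameCycle_revCycle [Finite V] : (σ.revCycle w).SameCycle x y ↔ σ.SameCycle x y := by
  constructor
  · intro h
    refine SameCycle.mem_of_forall_mem h (T := {z | σ.SameCycle x z}) (fun a ha => ?_) (.refl _ _)
    by_cases hw : σ.SameCycle w a
    · rw [revCycle_apply_of_sameCycle hw]; exact (sameCycle_apply_right (f := σ)).mp (by simpa using ha)
    · rw [revCycle_apply_of_not_sameCycle hw]; exact sameCycle_apply_right.mpr ha
  · intro h
    refine SameCycle.mem_of_forall_mem h (T := {z | (σ.revCycle w).SameCycle x z})
      (fun a ha => ?_) (.refl _ _)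
    by_cases hw : σ.SameCycle w a
    · have h1 : σ.revCycle w (σ a) = a := by
        rw [revCycle_apply_of_sameCycle (sameCycle_apply_right.mpr hw), ← mul_apply, inv_mul_cancel, one_apply]
      refine sameCycle_apply_right.mp (?_ : (σ.revCycle w).SameCycle x (σ.revCycle w (σ a)))
      rw [h1]; exact ha
    · have := sameCycle_apply_right.mpr ha
      rwa [revCycle_apply_of_not_sameCycle hw] at this

theorem revCycle_revCycle [Finite V] {z : V} (h : σ.SameCycle w z) :
    (σ.revCycle w).revCycle z = σ := by
  ext a
  by_cases hw : σ.SameCycle w a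
  · rw [revCycle_apply_of_sameCycle (sameCycle_revCycle.mpr (h.symm.trans hw)), inv_eq_iff_eq,
      revCycle_apply_of_sameCycle (sameCycle_apply_right.mpr hw), ← mul_apply, inv_mul_cancel, one_apply]
  · rw [revCycle_apply_of_not_sameCycle (fun hc => hw (h.trans (sameCycle_revCycle.mp hc))),
      revCycle_apply_of_not_sameCycle hw]

theorem numCycles_revCycle [Finite V] : (σ.revCycle w).numCycles = σ.numCycles := by
  have : SameCycle.setoid (σ.revCycle w) = SameCycle.setoid σ :=
    Setoid.ext fun _ _ => sameCycle_revCycle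
  rw [numCycles, numCycles, this]

end RevCycle

end Equiv.Perm

/-! ### Patching two cycles along undirected edges -/

namespace Equiv.Perm

variable {V : Type*} [DecidableEq V]

/-- Replace the arcs at `w` and `y`, lying on different cycles, by the edges `{y, w}` and
`{σ w, σ y}`, reversing the cycle through `w`. -/
noncomputable def patch (σ : Perm V) (w y : V) : Perm V := σ.revCycle w * swap y (σ w)

variable {σ : Perm V} {w y : V}

theorem patch_apply_left : σ.patch w y y = w := by
  rw [patch, mul_apply, swap_apply_left,
    revCycle_apply_of_sameCycle (sameCycle_apply_right.mpr (.refl _ _)), ← mul_apply,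
    inv_mul_cancel, one_apply]

theorem patch_apply_right (h : ¬ σ.SameCycle w y) : σ.patch w y (σ w) = σ y := by
  rw [patch, mul_apply, swap_apply_right, revCycle_apply_of_not_sameCycle h]

/-- The arcs leaving `w` and `y` are removed, so they need not be edges; every other arc survives,
possibly reversed. This freedom lets a patch repair a bad arc. -/
theorem adj_patch {G : SimpleGraph V} (h : ¬ σ.SameCycle w y)
    (hσ : ∀ a, a ≠ w → a ≠ y → G.Adj a (σ a)) (hyw : G.Adj y w) (hadj : G.Adj (σ w) (σ y))
    (a : V) : G.Adj a (σ.patch w y a) := by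
  by_cases hay : a = y
  · rw [hay, patch_apply_left]; exact hyw
  by_cases haz : a = σ w
  · rw [haz, patch_apply_right h]; exact hadj
  rw [patch, mul_swap_apply_of_ne hay haz]
  by_cases hc : σ.SameCycle w a
  · rw [revCycle_apply_of_sameCycle hc]
    have := hσ (σ⁻¹ a) (fun e => haz (by rw [← e]; simp)) (fun e => h ?_)
    · simpa using this.symm
    · rw [← e]
      exact sameCycle_apply_right.mp (by simpa using hc)
  · rw [revCycle_apply_of_not_sameCycle hc]
    exact hσ a (fun e => hc (e ▸ .refl _ _)) hay

/-- At most one cycle contains more than half of the points. -/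
theorem numCycles_le_card_add_one [Fintype V] (σ : Perm V) [DecidableRel σ.SameCycle] :
    σ.numCycles ≤ ({u : V | 2 * ({z : V | σ.SameCycle u z} : Finset V).card ≤
      Fintype.card V} : Finset V).card + 1 := by
  classical
  set U : Finset V := {u : V | 2 * ({z : V | σ.SameCycle u z} : Finset V).card ≤ Fintype.card V}
    with hU
  rw [numCycles, Nat.card_eq_fintype_card, ← Fintype.card_coe, ← Fintype.card_option]
  let F : Quotient (SameCycle.setoid σ) → Option U :=
    fun q => if h : q.out ∈ U then some ⟨q.out, h⟩ else none
  refine Fintype.card_le_of_injective F fun q q' hqq => ?_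
  by_cases hq : q.out ∈ U <;> by_cases hq' : q'.out ∈ U
  · simp only [F, hq, hq', dite_true, Option.some.injEq, Subtype.mk.injEq] at hqq
    exact Quotient.out_inj.mp hqq
  · simp [F, hq, hq'] at hqq
  · simp [F, hq, hq'] at hqq
  · by_contra hne
    have hns : ¬ σ.SameCycle q.out q'.out := fun hc => hne (by
      rw [← Quotient.out_eq q, ← Quotient.out_eq q']; exact Quotient.sound hc)
    have hdisj : _root_.Disjoint ({z : V | σ.SameCycle q.out z} : Finset V)
        ({z : V | σ.SameCycle q'.out z} : Finset V) := by
      rw [Finset.disjoint_left]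
      intro z hz hz'
      simp only [Finset.mem_filter, Finset.mem_univ, true_and] at hz hz'
      exact hns (hz.trans hz'.symm)
    have h1 := Finset.card_le_univ (({z : V | σ.SameCycle q.out z} : Finset V) ∪
      ({z : V | σ.SameCycle q'.out z} : Finset V))
    rw [Finset.card_union_of_disjoint hdisj] at h1
    simp only [hU, Finset.mem_filter, Finset.mem_univ, true_and, not_le] at hq hq'
    omega

variable [Finite V]

/-- A patch can be undone from its result together with `y` and `σ w`; this gives injectivity of the
switching. -/
theorem patch_recover : (σ.patch w y * swap y (σ w)).revCycle (σ w) = σ := by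
  rw [patch, mul_assoc, swap_mul_self, mul_one]
  exact revCycle_revCycle (sameCycle_apply_right.mpr (.refl _ _))

theorem numCycles_patch_lt (h : ¬ σ.SameCycle w y) : (σ.patch w y).numCycles < σ.numCycles := by
  have := numCycles_mul_swap_lt (σ := σ.revCycle w) (u := y) (v := σ w) (fun hc => h ?_)
  · rwa [numCycles_revCycle] at this
  · exact (sameCycle_apply_right.mp (sameCycle_revCycle.mp hc)).symm

end Equiv.Perm

/-! ### Switching: reducing the number of cycles -/

namespace SimpleGraph

open Equiv Equiv.Perm

variable {V : Type*} [Fintype V] (G : SimpleGraph V) [DecidableRel G.Adj]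

theorem card_filter_adj_apply (τ : Perm V) (v : V) :
    ({w : V | G.Adj (τ w) v} : Finset V).card = G.degree v := by
  rw [← G.card_neighborFinset_eq_degree]
  refine Finset.card_bij (fun w _ => τ w) ?_ (fun _ _ _ _ h => τ.injective h) ?_
  · intro w hw
    simpa [G.adj_comm v] using hw
  · intro z hz
    exact ⟨τ⁻¹ z, by simpa [G.adj_comm v] using hz, by simp⟩

variable [DecidableEq V]

theorem two_mul_le_card_add_card_crossing {x : ℝ} (hx : ∀ v, x ≤ G.degree v) (τ : Perm V)
    (y z : V) : 2 * x ≤ Fintype.card V +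
      (({w : V | G.Adj w y ∧ G.Adj (τ w) z} : Finset V).card : ℝ) := by
  have h1 := Finset.card_union_add_card_inter ({w : V | G.Adj w y} : Finset V)
    ({w : V | G.Adj (τ w) z} : Finset V)
  have h2 := Finset.card_le_univ (({w : V | G.Adj w y} : Finset V) ∪
    ({w : V | G.Adj (τ w) z} : Finset V))
  have h4 : ({w : V | G.Adj w y} : Finset V).card = G.degree y := G.card_filter_adj_apply 1 y
  rw [G.card_filter_adj_apply, h4, ← Finset.filter_and] at h1
  have h3 : (G.degree y : ℝ) + G.degree z ≤
      Fintype.card V + (({w : V | G.Adj w y ∧ G.Adj (τ w) z} : Finset V).card : ℝ) := by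
    exact_mod_cast (by omega)
  linarith [hx y, hx z]

/-- At most half of the points lie on the cycle of `u`, so when `x` exceeds half the order, many `v`
with `σ v ~ u` lie off it. -/
theorem le_card_add_card_exits {x : ℝ} (hx : ∀ v, x ≤ G.degree v) (σ : Perm V)
    [DecidableRel σ.SameCycle] {u : V}
    (hu : 2 * ({z : V | σ.SameCycle u z} : Finset V).card ≤ Fintype.card V) :
    2 * x ≤ Fintype.card V +
      2 * (({v : V | ¬ σ.SameCycle u v ∧ G.Adj (σ v) u} : Finset V).card : ℝ) := by
  have h1 : ({v : V | G.Adj (σ v) u} : Finset V) ⊆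
      ({z : V | σ.SameCycle u z} : Finset V) ∪
        ({v : V | ¬ σ.SameCycle u v ∧ G.Adj (σ v) u} : Finset V) := by
    intro v hv
    simp only [Finset.mem_filter, Finset.mem_univ, true_and, Finset.mem_union] at hv ⊢
    tauto
  have h2 := (Finset.card_le_card h1).trans (Finset.card_union_le _ _)
  rw [G.card_filter_adj_apply] at h2
  have h3 : 2 * (G.degree u : ℝ) ≤ Fintype.card V +
      2 * (({v : V | ¬ σ.SameCycle u v ∧ G.Adj (σ v) u} : Finset V).card : ℝ) := by
    exact_mod_cast (by omega)
  linarith [hx u]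

/-- The permutations along edges of `G` with at most `k` cycles. -/
noncomputable def adjPermsLE (k : ℕ) : Finset (Perm V) := {σ ∈ G.adjPerms | σ.numCycles ≤ k}

/-- Double counting of switchings. With `u` on a cycle of at most half the points and `v` off it
with `σ v ~ u`, `τ = σ * swap u v` merges two cycles, and only its arc `v → τ v` may fail to be an
edge. A vertex `w` with `w ~ v` and `τ w ~ τ v` repairs it. There are at least `k`, `K / 2` and `K`
choices of `u`, `v`, `w`. -/
theorem card_mul_crossings_le {x K : ℝ} (hx : ∀ v, x ≤ G.degree v)
    (hK : 0 < K) (hxK : Fintype.card V + K ≤ 2 * x) (k : ℕ) :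
    (({σ ∈ G.adjPerms | σ.numCycles = k + 1} : Finset (Perm V)).card : ℝ) * (k * (K / 2 * K)) ≤
      2 * (Fintype.card V : ℝ) ^ 3 * (G.adjPermsLE k).card := by
  classical
  let S : Finset (Σ _ : Perm V, Σ _ : V, Σ _ : V, V) :=
    ({σ ∈ G.adjPerms | σ.numCycles = k + 1} : Finset (Perm V)).sigma fun σ =>
      ({u : V | 2 * ({z : V | σ.SameCycle u z} : Finset V).card ≤
        Fintype.card V} : Finset V).sigma fun u =>
      ({v : V | ¬ σ.SameCycle u v ∧ G.Adj (σ v) u} : Finset V).sigma fun v =>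
      ({w : V | G.Adj w v ∧ G.Adj ((σ * swap u v) w) ((σ * swap u v) v)} : Finset V)
  have hlow : (({σ ∈ G.adjPerms | σ.numCycles = k + 1} : Finset (Perm V)).card : ℝ) *
      (k * (K / 2 * K)) ≤ S.card := by
    simp only [S, Finset.card_sigma, Nat.cast_sum]
    rw [← nsmul_eq_mul, ← Finset.sum_const]
    refine Finset.sum_le_sum fun σ hσ => ?_
    have hcyc : σ.numCycles = k + 1 := (Finset.mem_filter.mp hσ).2
    have hU := σ.numCycles_le_card_add_one
    rw [hcyc, add_le_add_iff_right] at hU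
    refine (mul_le_mul_of_nonneg_right (Nat.cast_le.mpr hU) (by positivity)).trans ?_
    rw [← nsmul_eq_mul, ← Finset.sum_const]
    refine Finset.sum_le_sum fun u hu => ?_
    have hV := G.le_card_add_card_exits hx σ (Finset.mem_filter.mp hu).2
    have hV' : K / 2 ≤
        (({v : V | ¬ σ.SameCycle u v ∧ G.Adj (σ v) u} : Finset V).card : ℝ) := by linarith
    refine (mul_le_mul_of_nonneg_right hV' hK.le).trans ?_
    rw [← nsmul_eq_mul, ← Finset.sum_const]
    refine Finset.sum_le_sum fun v _ => ?_
    linarith [G.two_mul_le_card_add_card_crossing hx (σ * swap u v) v ((σ * swap u v) v)]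
  -- Off the cycle of `v`, patching at `w` and `v` merges again. On that cycle, it is first split by
  -- `swap w v` and then patched back, with no net gain of cycles. Both insert the edges `{v, w}`
  -- and `{τ w, τ v}`. The three vertices and the flag make `f` injective.
  let f : (Σ _ : Perm V, Σ _ : V, Σ _ : V, V) → Perm V × V × V × V × Bool :=
    fun ⟨σ, u, v, w⟩ =>
      if (σ * swap u v).SameCycle w v then
        (((σ * swap u v) * swap w v).patch v w, u, w, (σ * swap u v * swap w v) v, false)
      else ((σ * swap u v).patch w v, u, v, (σ * swap u v) w, true)
  have hup : S.card ≤ (G.adjPermsLE k ×ˢ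
      (Finset.univ : Finset (V × V × V × Bool))).card := by
    refine Finset.card_le_card_of_injOn f ?_ ?_
    · rintro ⟨σ, u, v, w⟩ hS
      simp only [S, Finset.coe_sigma, Set.mem_sigma_iff, Finset.mem_coe, Finset.mem_filter,
        Finset.mem_univ, true_and] at hS
      obtain ⟨⟨hσ, hcyc⟩, -, ⟨huv, huv'⟩, hw, hw'⟩ := hS
      rw [mem_adjPerms] at hσ
      have hlt := numCycles_mul_swap_lt huv
      set τ := σ * swap u v with hτ
      have hτadj : ∀ a, a ≠ v → G.Adj a (τ a) := by
        intro a ha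
        by_cases hau : a = u
        · rw [hau, hτ, Perm.mul_apply, swap_apply_left]; exact huv'.symm
        · rw [hτ, mul_swap_apply_of_ne hau ha]; exact hσ a
      simp only [Finset.coe_product, Finset.coe_univ, Set.mem_prod, Finset.mem_coe, Set.mem_univ,
        and_true, adjPermsLE, Finset.mem_filter, mem_adjPerms]
      by_cases hc : τ.SameCycle w v
      · have hwv : w ≠ v := hw.ne
        have hsplit := not_sameCycle_mul_swap hwv hc.symm
        have hle := numCycles_mul_swap_le_of_sameCycle hwv hc.symm
        have hlt' := numCycles_patch_lt (fun h => hsplit h.symm)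
        simp only [f, ← hτ, hc, if_true]
        refine ⟨fun a => adj_patch (fun h => hsplit h.symm) (fun a hav haw => ?_) hw ?_ a, by omega⟩
        · rw [mul_swap_apply_of_ne haw hav]; exact hτadj a hav
        · simpa using hw'
      · have hlt' := numCycles_patch_lt hc
        simp only [f, ← hτ, hc, if_false]
        exact ⟨fun a => adj_patch hc (fun a _ hav => hτadj a hav) hw.symm hw' a, by omega⟩
    · rintro ⟨σ, u, v, w⟩ - ⟨σ', u', v', w'⟩ - heq
      suffices h : (σ * swap u v) = (σ' * swap u' v') ∧ u = u' ∧ v = v' ∧ w = w' by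
        obtain ⟨h1, rfl, rfl, rfl⟩ := h
        rw [mul_left_inj] at h1
        rw [h1]
      by_cases hc : (σ * swap u v).SameCycle w v <;> by_cases hc' : (σ' * swap u' v').SameCycle w' v'
      · simp only [f, hc, hc', if_true, Prod.mk.injEq, and_true] at heq
        set τ := σ * swap u v
        set τ' := σ' * swap u' v'
        obtain ⟨h1, h2, h3, h4⟩ := heq
        have e1 := patch_recover (σ := τ * swap w v) (w := v) (y := w)
        have e2 := patch_recover (σ := τ' * swap w' v') (w := v') (y := w')
        have e3 := patch_apply_left (σ := τ * swap w v) (w := v) (y := w)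
        have e4 := patch_apply_left (σ := τ' * swap w' v') (w := v') (y := w')
        have hv : v = v' := by rw [← e3, ← e4, h1, h3]
        have : τ * swap w v = τ' * swap w' v' := by rw [← e1, ← e2, h1, h4, h3]
        rw [hv, h3, mul_left_inj] at this
        exact ⟨this, h2, hv, h3⟩
      · simp [f, hc, hc'] at heq
      · simp [f, hc, hc'] at heq
      · simp only [f, hc, hc', if_false, Prod.mk.injEq, and_true] at heq
        set τ := σ * swap u v
        set τ' := σ' * swap u' v'
        obtain ⟨h1, h2, h3, h4⟩ := heq
        have e1 := patch_recover (σ := τ) (w := w) (y := v)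
        have e2 := patch_recover (σ := τ') (w := w') (y := v')
        have : τ = τ' := by rw [← e1, ← e2, h1, h3, h4]
        refine ⟨this, h2, h3, ?_⟩
        rw [← this] at h4
        exact τ.injective h4
  have hcard : (G.adjPermsLE k ×ˢ (Finset.univ : Finset (V × V × V × Bool))).card =
      (G.adjPermsLE k).card * (Fintype.card V * (Fintype.card V * (Fintype.card V * 2))) := by
    rw [Finset.card_product, Finset.card_univ]
    simp only [Fintype.card_prod, Fintype.card_bool]
  rw [hcard] at hup
  have hup' : (S.card : ℝ) ≤ (G.adjPermsLE k).card *
      (Fintype.card V * (Fintype.card V * (Fintype.card V * 2))) := by exact_mod_cast hup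
  calc _ ≤ _ := hlow
    _ ≤ _ := hup'
    _ = _ := by ring

/-- Iterates the switching bound. The step from `k + 1` to `k + 2` cycles costs a factor `O(n / (k +
2))`: the bound `k + 2 ≤ 2 * (k + 1)` turns the constant `4` into `8`, and `k + 2 ≤ n` absorbs the
term already counted. -/
theorem factorial_mul_card_adjPermsLE_le {x K : ℝ} (hx : ∀ v, x ≤ G.degree v)
    (hK : 0 < K) (hxK : Fintype.card V + K ≤ 2 * x) (k : ℕ) (hk : k + 1 ≤ Fintype.card V) :
    ((k + 1).factorial : ℝ) * (G.adjPermsLE (k + 1)).card ≤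
      (Fintype.card V * (1 + 8 * (Fintype.card V : ℝ) ^ 2 / K ^ 2)) ^ k *
        (G.adjPermsLE 1).card := by
  set n : ℝ := (Fintype.card V : ℝ) with hn
  induction k with
  | zero => simp
  | succ k ih =>
    have ih := ih (by omega)
    have hsplit : (G.adjPermsLE (k + 1 + 1)).card ≤ (G.adjPermsLE (k + 1)).card +
        ({σ ∈ G.adjPerms | σ.numCycles = k + 1 + 1} : Finset (Perm V)).card := by
      refine le_trans (Finset.card_le_card ?_) (Finset.card_union_le _ _)
      intro σ hσ
      simp only [adjPermsLE, Finset.mem_filter, Finset.mem_union] at hσ ⊢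
      have := hσ.2
      rcases Nat.lt_or_ge σ.numCycles (k + 1 + 1) with h | h
      · exact .inl ⟨hσ.1, by omega⟩
      · exact .inr ⟨hσ.1, by omega⟩
    have hstep := G.card_mul_crossings_le hx hK hxK (k + 1)
    rw [← hn] at hstep
    set M := ((G.adjPermsLE (k + 1)).card : ℝ)
    set M' := ((G.adjPermsLE (k + 1 + 1)).card : ℝ)
    set R := (({σ ∈ G.adjPerms | σ.numCycles = k + 1 + 1} : Finset (Perm V)).card : ℝ)
    have hsplit' : M' ≤ M + R := by
      simp only [M, M', R]; exact_mod_cast hsplit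
    have hM : 0 ≤ M := Nat.cast_nonneg _
    have hkn : ((k + 1 + 1 : ℕ) : ℝ) ≤ n := by rw [hn]; exact_mod_cast hk
    have hR : ((k + 1 + 1 : ℕ) : ℝ) * R ≤ n * (8 * n ^ 2 / K ^ 2) * M := by
      have h1 : R * ((k + 1 : ℕ) : ℝ) ≤ 4 * n ^ 3 / K ^ 2 * M := by
        rw [div_mul_eq_mul_div, le_div_iff₀ (by positivity)]
        linarith
      have h2 : ((k + 1 + 1 : ℕ) : ℝ) ≤ 2 * ((k + 1 : ℕ) : ℝ) := by
        push_cast; linarith [(Nat.cast_nonneg k : (0:ℝ) ≤ k)]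
      have hR0 : 0 ≤ R := Nat.cast_nonneg _
      calc ((k + 1 + 1 : ℕ) : ℝ) * R ≤ 2 * ((k + 1 : ℕ) : ℝ) * R := by gcongr
        _ = 2 * (R * ((k + 1 : ℕ) : ℝ)) := by ring
        _ ≤ 2 * (4 * n ^ 3 / K ^ 2 * M) := by gcongr
        _ = _ := by ring
    have hn0 : 0 ≤ n := Nat.cast_nonneg _
    calc ((k + 1 + 1).factorial : ℝ) * M'
        = ((k + 1).factorial : ℝ) * (((k + 1 + 1 : ℕ) : ℝ) * M') := by
          rw [Nat.factorial_succ (k + 1)]; push_cast; ring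
      _ ≤ ((k + 1).factorial : ℝ) * (n * (1 + 8 * n ^ 2 / K ^ 2) * M) := by
          refine mul_le_mul_of_nonneg_left ?_ (Nat.cast_nonneg _)
          calc ((k + 1 + 1 : ℕ) : ℝ) * M' ≤ ((k + 1 + 1 : ℕ) : ℝ) * (M + R) := by gcongr
            _ = ((k + 1 + 1 : ℕ) : ℝ) * M + ((k + 1 + 1 : ℕ) : ℝ) * R := by ring
            _ ≤ n * M + n * (8 * n ^ 2 / K ^ 2) * M := by gcongr
            _ = n * (1 + 8 * n ^ 2 / K ^ 2) * M := by ring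
      _ = n * (1 + 8 * n ^ 2 / K ^ 2) * (((k + 1).factorial : ℝ) * M) := by ring
      _ ≤ n * (1 + 8 * n ^ 2 / K ^ 2) * _ := mul_le_mul_of_nonneg_left ih (by positivity)
      _ = _ := by rw [pow_succ]; ring

end SimpleGraph

/-! ### One-cycle permutations and Hamilton cycles -/

namespace SimpleGraph

open Equiv Equiv.Perm

variable {V : Type*} (G : SimpleGraph V)

/-- The spanning subgraph of `G` formed by the arcs of a permutation. -/
def permSubgraph (σ : Perm V) : G.Subgraph where
  verts := Set.univ
  Adj a b := G.Adj a b ∧ (σ a = b ∨ σ b = a)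
  adj_sub h := h.1
  edge_vert _ := Set.mem_univ _
  symm := ⟨fun _ _ h => ⟨h.1.symm, h.2.symm⟩⟩

variable {G}

theorem exists_walk_getVert_eq_pow {σ : Perm V} (hσ : ∀ v, G.Adj v (σ v)) (k : ℕ) (v : V) :
    ∃ (w : V) (p : G.Walk v w), p.length = k ∧ ∀ i ≤ k, p.getVert i = (σ ^ i) v := by
  induction k generalizing v with
  | zero => exact ⟨v, .nil, rfl, fun i hi => by simp [Nat.le_zero.mp hi]⟩
  | succ k ih =>
    obtain ⟨w, p, hp, hpi⟩ := ih (σ v)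
    refine ⟨w, .cons (hσ v) p, by simp [hp], fun i hi => ?_⟩
    cases i with
    | zero => simp
    | succ i =>
      rw [Walk.getVert_cons_succ, hpi i (by omega), pow_succ, mul_apply]

variable [Fintype V]

theorem isCycleOn_of_numCycles_le_one {σ : Perm V} (h : σ.numCycles ≤ 1) :
    σ.IsCycleOn (Finset.univ : Finset V) := by
  refine ⟨by simp, fun x _ y _ => ?_⟩
  rw [numCycles, Finite.card_le_one_iff_subsingleton] at h
  exact Quotient.exact (s := SameCycle.setoid σ) (Subsingleton.elim _ _)

theorem eq_of_permSubgraph_eq {σ τ : Perm V} (hσ : ∀ v, G.Adj v (σ v)) (hc : σ.numCycles ≤ 1)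
    (hn : 3 ≤ Fintype.card V) (h : G.permSubgraph σ = G.permSubgraph τ) {v : V}
    (hv : σ v = τ v) : σ = τ := by
  have hon := isCycleOn_of_numCycles_le_one hc
  have key : ∀ i : ℕ, (σ ^ i) v = (τ ^ i) v ∧ (σ ^ (i + 1)) v = (τ ^ (i + 1)) v := by
    intro i
    induction i with
    | zero => simpa using hv
    | succ i ih =>
      refine ⟨ih.2, ?_⟩
      have hadj : (G.permSubgraph τ).Adj ((σ ^ (i + 1)) v) (σ ((σ ^ (i + 1)) v)) := by
        rw [← h]; exact ⟨hσ _, .inl rfl⟩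
      rcases hadj.2 with h1 | h1
      · rw [pow_succ' σ (i + 1), pow_succ' τ (i + 1), mul_apply, mul_apply, ← h1, ih.2]
      -- Traversal in the opposite direction would give `σ^(i+2) v = σ^i v`, impossible on a cycle
      -- of length at least three.
      · exfalso
        rw [ih.2] at h1
        nth_rw 2 [pow_succ'] at h1
        rw [mul_apply] at h1
        have h2 := τ.injective h1
        rw [← ih.2, ← ih.1, ← mul_apply, ← pow_succ',
          hon.pow_apply_eq_pow_apply (Finset.mem_univ v)] at h2
        have h3 : 2 ≡ 0 [MOD (Finset.univ : Finset V).card] :=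
          Nat.ModEq.add_right_cancel' i (by rw [zero_add, add_comm]; exact h2)
        have := h3.eq_of_lt_of_lt (by rw [Finset.card_univ]; omega)
          (by rw [Finset.card_univ]; omega)
        omega
  ext z
  obtain ⟨i, -, rfl⟩ := hon.exists_pow_eq (Finset.mem_univ v) (Finset.mem_univ z)
  have h1 := (key i).1
  have h2 := (key i).2
  rw [pow_succ', pow_succ', mul_apply, mul_apply, ← h1] at h2
  exact h2

variable [DecidableEq V]

theorem exists_isHamiltonianCycle_toSubgraph_eq_permSubgraph {σ : Perm V}
    (hσ : ∀ v, G.Adj v (σ v)) (hc : σ.numCycles ≤ 1) (hn : 3 ≤ Fintype.card V) :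
    ∃ (v : V) (p : G.Walk v v), p.IsHamiltonianCycle ∧ p.toSubgraph = G.permSubgraph σ := by
  have hon := isCycleOn_of_numCycles_le_one hc
  have : Nonempty V := Fintype.card_pos_iff.mp (by omega)
  let v : V := Classical.arbitrary V
  obtain ⟨w, p, hp, hpi⟩ := exists_walk_getVert_eq_pow hσ (Fintype.card V) v
  have hmod : ∀ i j, (σ ^ i) v = (σ ^ j) v ↔ i ≡ j [MOD Fintype.card V] := fun i j =>
    hon.pow_apply_eq_pow_apply (Finset.mem_univ v)
  have hw : w = v := by
    rw [← p.getVert_length, hp, hpi _ le_rfl]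
    exact hon.pow_card_apply (Finset.mem_univ v)
  subst hw
  have hcyc : p.IsCycle := by
    rw [Walk.isCycle_iff_isPath_tail_and_le_length, hp]
    refine ⟨?_, hn⟩
    rw [← Walk.IsPath.getVert_injOn_iff]
    have hnil : ¬ p.Nil := by rw [Walk.not_nil_iff_lt_length]; omega
    have hlen := Walk.length_tail_add_one hnil
    intro i hi j hj hij
    simp only [Set.mem_ofPred_eq] at hi hj
    rw [Walk.getVert_tail, Walk.getVert_tail, hpi _ (by omega), hpi _ (by omega), hmod] at hij
    have := Nat.ModEq.add_right_cancel' 1 hij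
    exact this.eq_of_lt_of_lt (by omega) (by omega)
  have hham := Walk.isHamiltonianCycle_iff_isCycle_and_length_eq.mpr ⟨hcyc, hp⟩
  refine ⟨v, p, hham, ?_⟩
  have hadj : ∀ a b, p.toSubgraph.Adj a b ↔ (G.permSubgraph σ).Adj a b := by
    intro a b
    rw [Walk.toSubgraph_adj_iff]
    constructor
    · rintro ⟨i, h, hi⟩
      rw [hpi _ (by omega), hpi _ (by omega), Sym2.eq_iff, pow_succ', mul_apply] at h
      rcases h with ⟨rfl, rfl⟩ | ⟨rfl, rfl⟩
      · exact ⟨hσ _, .inl rfl⟩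
      · exact ⟨(hσ _).symm, .inr rfl⟩
    · have key : ∀ a, ∃ i < p.length, (σ ^ i) v = a := fun a => by
        rw [hp]
        exact hon.exists_pow_eq (Finset.mem_univ v) (Finset.mem_univ a)
      rintro ⟨-, rfl | rfl⟩
      · obtain ⟨i, hi, rfl⟩ := key a
        refine ⟨i, ?_, hi⟩
        rw [hpi _ (by omega), hpi _ (by omega), pow_succ', mul_apply]
      · obtain ⟨i, hi, rfl⟩ := key b
        refine ⟨i, ?_, hi⟩
        rw [hpi _ (by omega), hpi _ (by omega), pow_succ', mul_apply, Sym2.eq_swap]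
  refine Subgraph.ext ?_ ?_
  · ext a
    simp only [Walk.mem_verts_toSubgraph, permSubgraph, Set.mem_univ, iff_true]
    exact hham.mem_support a
  · ext a b; exact hadj a b

/-- The image of one vertex fixes the direction of traversal. The crude factor `n` is harmless at
exponential scale. -/
theorem card_adjPermsLE_one_le [DecidableRel G.Adj] (hn : 3 ≤ Fintype.card V) :
    (G.adjPermsLE 1).card ≤ Fintype.card V * numHamiltonCycles G := by
  have : Nonempty V := Fintype.card_pos_iff.mp (by omega)
  let v : V := Classical.arbitrary V
  rw [numHamiltonCycles, ← Nat.card_eq_fintype_card, ← Set.ncard_univ, ← Set.ncard_prod,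
    ← Set.ncard_coe_finset]
  refine Set.ncard_le_ncard_of_injOn (fun σ => (σ v, G.permSubgraph σ)) ?_ ?_ (Set.toFinite _)
  · intro σ hσ
    rw [Finset.mem_coe, adjPermsLE, Finset.mem_filter, mem_adjPerms] at hσ
    exact ⟨Set.mem_univ _,
      exists_isHamiltonianCycle_toSubgraph_eq_permSubgraph hσ.1 hσ.2 hn⟩
  · intro σ hσ τ _ h
    rw [Finset.mem_coe, adjPermsLE, Finset.mem_filter, mem_adjPerms] at hσ
    rw [Prod.mk.injEq] at h
    exact eq_of_permSubgraph_eq hσ.1 hσ.2 hn h.2 h.1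

theorem Walk.IsHamiltonianCycle.exists_permSubgraph_eq {v : V} {p : G.Walk v v}
    (hp : p.IsHamiltonianCycle) :
    ∃ σ : Perm V, (∀ a, G.Adj a (σ a)) ∧ G.permSubgraph σ = p.toSubgraph := by
  have hlen := hp.length_eq
  have h3 := hp.isCycle.three_le_length
  obtain ⟨m, hm⟩ : ∃ m, p.length = m + 1 := ⟨p.length - 1, by omega⟩
  have hinj : Function.Injective fun i : Fin (m + 1) => p.getVert i := by
    intro i j hij
    exact Fin.ext (hp.isCycle.getVert_injOn' (by have := i.2; simp; omega)
      (by have := j.2; simp; omega) hij)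
  have hbij := (Fintype.bijective_iff_injective_and_card _).mpr
    ⟨hinj, by rw [Fintype.card_fin, ← hm, hlen]⟩
  let e : Fin (m + 1) ≃ V := Equiv.ofBijective _ hbij
  -- The rotation of the positions along the walk, transported to the vertices.
  let σ : Perm V := (e.symm.trans (finRotate (m + 1))).trans e
  have hσ : ∀ i < p.length, σ (p.getVert i) = p.getVert (i + 1) := by
    intro i hi
    have h1 : p.getVert i = e ⟨i, by omega⟩ := rfl
    rw [h1]
    simp only [σ, Equiv.trans_apply, Equiv.symm_apply_apply]
    change p.getVert ((finRotate (m + 1)) ⟨i, _⟩ : Fin (m + 1)) = _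
    rw [coe_finRotate]
    split_ifs with h
    · have : i + 1 = p.length := by
        have := congrArg Fin.val h
        simp at this; omega
      rw [this, Walk.getVert_length, Walk.getVert_zero]
    · rfl
  have hsurj : ∀ a, ∃ i < p.length, p.getVert i = a := fun a => by
    obtain ⟨i, hi⟩ := hbij.2 a
    exact ⟨i, by have := i.2; omega, hi⟩
  have hadj : ∀ a, G.Adj a (σ a) := by
    intro a
    obtain ⟨i, hi, rfl⟩ := hsurj a
    rw [hσ i hi]
    exact p.adj_getVert_succ hi
  refine ⟨σ, hadj, Subgraph.ext ?_ ?_⟩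
  · ext a
    simp only [Walk.mem_verts_toSubgraph, permSubgraph, Set.mem_univ, true_iff]
    exact hp.mem_support a
  · ext a b
    rw [Walk.toSubgraph_adj_iff]
    constructor
    · rintro ⟨-, rfl | rfl⟩
      · obtain ⟨i, hi, rfl⟩ := hsurj a
        exact ⟨i, by rw [hσ i hi], hi⟩
      · obtain ⟨i, hi, rfl⟩ := hsurj b
        exact ⟨i, by rw [hσ i hi, Sym2.eq_swap], hi⟩
    · rintro ⟨i, h, hi⟩
      rw [← hσ i hi, Sym2.eq_iff] at h
      rcases h with ⟨rfl, rfl⟩ | ⟨rfl, rfl⟩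
      · exact ⟨hadj _, .inl rfl⟩
      · exact ⟨(hadj _).symm, .inr rfl⟩

theorem numHamiltonCycles_le_card_adjPerms [DecidableRel G.Adj] :
    numHamiltonCycles G ≤ G.adjPerms.card := by
  rw [numHamiltonCycles, ← Set.ncard_coe_finset]
  refine (Set.ncard_le_ncard ?_ (Set.toFinite _)).trans
    (Set.ncard_image_le (f := G.permSubgraph) (Set.toFinite _))
  rintro H ⟨v, p, hp, rfl⟩
  obtain ⟨σ, h1, h2⟩ := hp.exists_permSubgraph_eq
  exact ⟨σ, by simpa [mem_adjPerms] using h1, h2⟩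

end SimpleGraph

/-! ### Brégman's theorem and the upper bound -/

/-- `log (d!) / d`, the contribution of a row with `d` ones to Brégman's bound. -/
noncomputable def bregmanLog (d : ℕ) : ℝ := Real.log d.factorial / d

theorem natCast_mul_bregmanLog (d : ℕ) : d * bregmanLog d = Real.log d.factorial := by
  rcases Nat.eq_zero_or_pos d with rfl | h
  · simp
  · rw [bregmanLog, mul_div_cancel₀]
    exact_mod_cast h.ne'

theorem log_add_pred_mul_bregmanLog {d : ℕ} (hd : 0 < d) :
    Real.log d + (d - 1 : ℕ) * bregmanLog (d - 1) = d * bregmanLog d := by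
  rw [natCast_mul_bregmanLog, natCast_mul_bregmanLog, ← Nat.mul_factorial_pred hd.ne',
    Nat.cast_mul, Real.log_mul (by exact_mod_cast hd.ne') (by exact_mod_cast Nat.factorial_ne_zero _)]

/-- Convexity of `x log x`. -/
theorem Finset.sum_mul_log_le {ι : Type*} (s : Finset ι) (p : ι → ℝ) (hp : ∀ i ∈ s, 0 ≤ p i)
    (hs : 0 < ∑ i ∈ s, p i) :
    (∑ i ∈ s, p i) * Real.log (∑ i ∈ s, p i) ≤
      (∑ i ∈ s, p i) * Real.log s.card + ∑ i ∈ s, p i * Real.log (p i) := by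
  set P := ∑ i ∈ s, p i with hP
  have hcard : (0 : ℝ) < s.card := by
    rcases s.eq_empty_or_nonempty with rfl | h
    · simp [hP] at hs
    · exact_mod_cast h.card_pos
  have hterm : ∀ i ∈ s, p i - P / s.card ≤ p i * Real.log (p i) - p i * Real.log (P / s.card) := by
    intro i hi
    rcases (hp i hi).eq_or_lt with h | h
    · rw [← h]; simp; positivity
    · have hq : 0 < P / s.card := by positivity
      have := Real.log_le_sub_one_of_pos (div_pos hq h)
      rw [Real.log_div hq.ne' h.ne'] at this
      have h2 := mul_le_mul_of_nonneg_left this h.le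
      have h3 : p i * (P / s.card / p i - 1) = P / s.card - p i := by field_simp
      rw [h3] at h2
      linarith
  have := Finset.sum_le_sum hterm
  rw [Finset.sum_sub_distrib, Finset.sum_sub_distrib, ← Finset.sum_mul, Finset.sum_const,
    nsmul_eq_mul, ← hP, mul_div_cancel₀ _ hcard.ne', sub_self,
    Real.log_div hs.ne' hcard.ne'] at this
  linarith

/-- Brégman's theorem, in logarithmic form. -/
theorem log_card_equiv_le_sum_bregmanLog.{u} (n : ℕ) : ∀ (α β : Type u) [Fintype α] [Fintype β]
    [DecidableEq α] [DecidableEq β] (r : α → β → Prop) [∀ a b, Decidable (r a b)],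
    Fintype.card α = n →
    ({σ : α ≃ β | ∀ a, r a (σ a)} : Finset (α ≃ β)).Nonempty →
    Real.log ({σ : α ≃ β | ∀ a, r a (σ a)} : Finset (α ≃ β)).card ≤
      ∑ a, bregmanLog ({b | r a b} : Finset β).card := by
  induction n with
  | zero =>
    intro α β _ _ _ _ r _ hα _
    have hα' := Fintype.card_eq_zero_iff.mp hα
    have : Subsingleton (α ≃ β) := ⟨fun σ τ => Equiv.ext fun a => hα'.elim a⟩
    rw [Fintype.sum_empty]
    refine Real.log_nonpos (Nat.cast_nonneg _) ?_
    exact_mod_cast Finset.card_le_one_of_subsingleton _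
  | succ n ih =>
    intro α β _ _ _ _ r _ hα hne
    set S : Finset (α ≃ β) := {σ : α ≃ β | ∀ a, r a (σ a)} with hS
    have hmem : ∀ σ, σ ∈ S ↔ ∀ a, r a (σ a) := fun σ => by simp [hS]
    set d : α → ℕ := fun a => ({b | r a b} : Finset β).card with hd
    have hSpos : (0 : ℝ) < S.card := by exact_mod_cast hne.card_pos
    have hdpos : ∀ a, 0 < d a := fun a => by
      obtain ⟨σ, hσ⟩ := hne
      exact Finset.card_pos.mpr ⟨σ a, by simpa using (hmem σ).mp hσ a⟩
    have hβ : Fintype.card β = n + 1 := by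
      obtain ⟨σ, -⟩ := hne
      rw [← Fintype.card_congr σ, hα]
    set p : α → β → ℕ := fun a b => (S.filter fun σ => σ a = b).card with hp
    -- Convexity of `x log x` for the partition of `S` by the image of `a`; `∑ p log p` over columns
    -- is rewritten as a sum over `σ ∈ S`.
    have hconv : ∀ a, (S.card : ℝ) * Real.log S.card ≤
        S.card * Real.log (d a) + ∑ σ ∈ S, Real.log (p a (σ a)) := by
      intro a
      have hmaps : ∀ σ ∈ S, σ a ∈ ({b | r a b} : Finset β) := fun σ hσ => by
        simpa using (hmem σ).mp hσ a
      have hsum : ∑ b ∈ ({b | r a b} : Finset β), (p a b : ℝ) = S.card := by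
        rw [Finset.card_eq_sum_card_fiberwise hmaps]
        push_cast
        rfl
      have h := Finset.sum_mul_log_le ({b | r a b} : Finset β) (fun b => (p a b : ℝ))
        (fun _ _ => Nat.cast_nonneg _) (by rw [hsum]; exact hSpos)
      rw [hsum] at h
      refine h.trans (le_of_eq ?_)
      rw [← Finset.sum_fiberwise_of_maps_to hmaps]
      congr 1
      refine Finset.sum_congr rfl fun b _ => ?_
      rw [Finset.sum_congr rfl (g := fun _ => Real.log (p a b)) fun σ hσ => by
        rw [(Finset.mem_filter.mp hσ).2], Finset.sum_const, nsmul_eq_mul]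
    have hminor : ∀ σ ∈ S, ∀ a, Real.log (p a (σ a)) ≤
        ∑ a' : {a' // a' ≠ a}, bregmanLog (d a' - if r a' (σ a) then 1 else 0) := by
      intro σ hσ a
      have hres : ∀ τ : α ≃ β, τ a = σ a → ∀ x, x ≠ a ↔ τ x ≠ σ a := by
        intro τ hτ x
        rw [← hτ, τ.injective.ne_iff]
      set S' : Finset ({a' // a' ≠ a} ≃ {b // b ≠ σ a}) :=
        {τ : {a' // a' ≠ a} ≃ {b // b ≠ σ a} | ∀ x : {a' // a' ≠ a}, r x (τ x)} with hS'
      have hle : p a (σ a) ≤ S'.card := by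
        simp only [hp]
        rw [← Fintype.card_coe, ← Fintype.card_coe]
        refine Fintype.card_le_of_injective
          (fun τ => ⟨τ.1.subtypeEquiv (hres τ.1 (Finset.mem_filter.mp τ.2).2), ?_⟩) ?_
        · simp only [hS', Finset.mem_filter, Finset.mem_univ, true_and]
          exact fun x => (hmem _).mp (Finset.mem_filter.mp τ.2).1 x
        · intro τ τ' h
          refine Subtype.ext (Equiv.ext fun x => ?_)
          by_cases hx : x = a
          · rw [hx, (Finset.mem_filter.mp τ.2).2, (Finset.mem_filter.mp τ'.2).2]
          · exact congrArg Subtype.val (DFunLike.congr_fun (congrArg Subtype.val h) ⟨x, hx⟩)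
      have hppos : 0 < p a (σ a) := Finset.card_pos.mpr ⟨σ, by simp [hσ]⟩
      have hih := ih {a' // a' ≠ a} {b // b ≠ σ a} (fun x y => r x y)
        (by rw [Fintype.card_subtype_compl, hα]; simp)
        (Finset.card_pos.mp (hppos.trans_le hle))
      refine (Real.log_le_log (by exact_mod_cast hppos) (by exact_mod_cast hle)).trans
        (hih.trans (le_of_eq ?_))
      refine Finset.sum_congr rfl fun x _ => ?_
      congr 1
      have h1 : ({y : {b // b ≠ σ a} | r x y} : Finset {b // b ≠ σ a}).card =
          (({b | r x b} : Finset β).erase (σ a)).card := by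
        refine Finset.card_bij (fun y _ => (y : β)) ?_ (fun _ _ _ _ h => Subtype.ext h) ?_
        · intro y hy
          simp only [Finset.mem_filter, Finset.mem_univ, true_and] at hy
          simp [y.2, hy]
        · intro b hb
          rw [Finset.mem_erase] at hb
          exact ⟨⟨b, hb.1⟩, by simpa using hb.2, rfl⟩
      rw [h1, Finset.card_erase_eq_ite]
      simp only [Finset.mem_filter, Finset.mem_univ, true_and, hd]
      split_ifs <;> simp
    -- For fixed `σ`, over all deleted rows `a ≠ a'`, row `a'` loses a one exactly `d a' - 1` times
    -- and is unchanged `n + 1 - d a'` times.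
    have hcount : ∀ σ ∈ S, ∑ a, ∑ a' : {a' // a' ≠ a},
        bregmanLog (d a' - if r a' (σ a) then 1 else 0) =
        ∑ a', ((d a' - 1 : ℕ) * bregmanLog (d a' - 1) + (n + 1 - d a' : ℝ) * bregmanLog (d a')) := by
      intro σ hσ
      have h1 : ∀ a, ∑ a' : {a' // a' ≠ a}, bregmanLog (d a' - if r a' (σ a) then 1 else 0) =
          ∑ a', if a' = a then 0 else bregmanLog (d a' - if r a' (σ a) then 1 else 0) := by
        intro a
        rw [← Finset.sum_subtype (Finset.univ.filter fun a' => a' ≠ a) (by simp)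
          (fun a' => bregmanLog (d a' - if r a' (σ a) then 1 else 0)), Finset.sum_filter]
        exact Finset.sum_congr rfl fun x _ => by rw [ite_not]
      rw [Finset.sum_congr rfl fun a _ => h1 a, Finset.sum_comm]
      refine Finset.sum_congr rfl fun a' _ => ?_
      have h2 : ∀ a, (if a' = a then 0 else bregmanLog (d a' - if r a' (σ a) then 1 else 0)) =
          (if r a' (σ a) then bregmanLog (d a' - 1) else bregmanLog (d a')) -
            if a' = a then bregmanLog (d a' - 1) else 0 := by
        intro a
        by_cases h : a' = a
        · subst h
          simp [(hmem σ).mp hσ a']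
        · by_cases h' : r a' (σ a) <;> simp [h, h']
      rw [Finset.sum_congr rfl fun a _ => h2 a, Finset.sum_sub_distrib,
        Equiv.sum_comp σ fun b => if r a' b then bregmanLog (d a' - 1) else bregmanLog (d a'),
        Finset.sum_ite, Finset.sum_const, Finset.sum_const, Finset.sum_ite_eq]
      have h3 := Finset.card_filter_add_card_filter_not (s := (Finset.univ : Finset β)) (r a')
      rw [Finset.card_univ, hβ] at h3
      have h4 : ((({b | ¬ r a' b} : Finset β).card : ℕ) : ℝ) = n + 1 - d a' := by
        have : ((d a' + ({b | ¬ r a' b} : Finset β).card : ℕ) : ℝ) = (n + 1 : ℕ) := by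
          exact_mod_cast h3
        push_cast at this
        linarith
      rw [nsmul_eq_mul, nsmul_eq_mul, h4, Nat.cast_sub (hdpos a')]
      simp only [Finset.mem_univ, if_true, Nat.cast_one]
      change (d a' : ℝ) * _ + _ - _ = _
      ring
    have htotal : ((n + 1 : ℕ) : ℝ) * (S.card * Real.log S.card) ≤
        S.card * (((n + 1 : ℕ) : ℝ) * ∑ a, bregmanLog (d a)) := by
      calc ((n + 1 : ℕ) : ℝ) * (S.card * Real.log S.card)
          = ∑ _a : α, (S.card : ℝ) * Real.log S.card := by
            rw [Finset.sum_const, Finset.card_univ, hα, nsmul_eq_mul]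
        _ ≤ ∑ a, (S.card * Real.log (d a) + ∑ σ ∈ S, Real.log (p a (σ a))) :=
            Finset.sum_le_sum fun a _ => hconv a
        _ = S.card * ∑ a, Real.log (d a) + ∑ σ ∈ S, ∑ a, Real.log (p a (σ a)) := by
            rw [Finset.sum_add_distrib, Finset.mul_sum, Finset.sum_comm]
        _ ≤ S.card * ∑ a, Real.log (d a) + ∑ σ ∈ S, ∑ a',
            ((d a' - 1 : ℕ) * bregmanLog (d a' - 1) +
              (n + 1 - d a' : ℝ) * bregmanLog (d a')) := by
            refine add_le_add_right (Finset.sum_le_sum fun σ hσ => ?_) _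
            rw [← hcount σ hσ]
            exact Finset.sum_le_sum fun a _ => hminor σ hσ a
        _ = S.card * ∑ a, (Real.log (d a) + ((d a - 1 : ℕ) * bregmanLog (d a - 1) +
              (n + 1 - d a : ℝ) * bregmanLog (d a))) := by
            rw [Finset.sum_const, nsmul_eq_mul, ← mul_add, ← Finset.sum_add_distrib]
        _ = _ := by
            congr 1
            rw [Finset.mul_sum]
            refine Finset.sum_congr rfl fun a _ => ?_
            rw [← add_assoc, log_add_pred_mul_bregmanLog (hdpos a)]
            push_cast
            ring
    have hn1 : (0 : ℝ) < (n + 1 : ℕ) := by positivity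
    rw [mul_left_comm] at htotal
    exact le_of_mul_le_mul_left (le_of_mul_le_mul_left htotal hSpos) hn1

theorem Real.log_factorial_le {d : ℕ} (hd : 0 < d) :
    Real.log d.factorial ≤ d * Real.log d - d + Real.log d + 1 := by
  induction d, hd using Nat.le_induction with
  | base => simp
  | succ d hd ih =>
    have hd0 : (0 : ℝ) < d := by exact_mod_cast hd
    have h1 : 1 - ((d + 1 : ℝ) / d)⁻¹ ≤ Real.log ((d + 1 : ℝ) / d) :=
      Real.one_sub_inv_le_log_of_pos (by positivity)
    rw [Real.log_div (by positivity) hd0.ne'] at h1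
    have h2 : (d + 1 : ℝ) * (1 - ((d + 1 : ℝ) / d)⁻¹) = 1 := by field_simp; ring
    have h3 := mul_le_mul_of_nonneg_left h1 (by positivity : (0 : ℝ) ≤ d + 1)
    rw [h2] at h3
    rw [Nat.factorial_succ, Nat.cast_mul, Real.log_mul (by positivity) (by positivity)]
    push_cast
    nlinarith

theorem bregmanLog_le {d : ℕ} (hd : 0 < d) :
    bregmanLog d ≤ Real.log d - 1 + (Real.log d + 1) / d := by
  have hd0 : (0 : ℝ) < d := by exact_mod_cast hd
  rw [bregmanLog, div_le_iff₀ hd0]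
  refine (Real.log_factorial_le hd).trans (le_of_eq ?_)
  field_simp
  ring

/-! ### Combining the counts -/

namespace SimpleGraph

open Equiv Equiv.Perm

variable {V : Type*} [Fintype V] [DecidableEq V] (G : SimpleGraph V) [DecidableRel G.Adj]

theorem card_adjPerms_le_pow [Nonempty V] {D η : ℝ}
    (hlow : ∀ v, (Fintype.card V : ℝ) / 4 ≤ G.degree v) (hD : ∀ v, (G.degree v : ℝ) ≤ D)
    (hη : 4 * (Real.log (Fintype.card V) + 1) ≤ η * Fintype.card V) :
    (G.adjPerms.card : ℝ) ≤ (D * Real.exp η / Real.exp 1) ^ Fintype.card V := by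
  have hn : (0 : ℝ) < Fintype.card V := by exact_mod_cast Fintype.card_pos
  have hdpos : ∀ v, (0 : ℝ) < G.degree v := fun v => lt_of_lt_of_le (by positivity) (hlow v)
  have hDpos : 0 < D := (hdpos (Classical.arbitrary V)).trans_le (hD _)
  rcases G.adjPerms.eq_empty_or_nonempty with h | h
  · rw [h, Finset.card_empty, Nat.cast_zero]; positivity
  have hbreg := log_card_equiv_le_sum_bregmanLog _ V V G.Adj rfl h
  change Real.log G.adjPerms.card ≤ _ at hbreg
  have hpos : (0 : ℝ) < G.adjPerms.card := by exact_mod_cast h.card_pos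
  have hdeg : ∀ v, ({w | G.Adj v w} : Finset V).card = G.degree v := fun v => by
    rw [← G.card_neighborFinset_eq_degree]; congr 1; ext w; simp
  have hterm : ∀ v, bregmanLog ({w | G.Adj v w} : Finset V).card ≤ Real.log D - 1 + η := by
    intro v
    rw [hdeg]
    have hdv := hdpos v
    refine (bregmanLog_le (by exact_mod_cast hdv)).trans ?_
    have h1 : Real.log (G.degree v) ≤ Real.log D := Real.log_le_log hdv (hD v)
    have h2 : Real.log (G.degree v) ≤ Real.log (Fintype.card V) :=
      Real.log_le_log hdv (by exact_mod_cast (G.degree_lt_card_verts v).le)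
    have h3 : (Real.log (G.degree v) + 1) / G.degree v ≤ η := by
      rw [div_le_iff₀ hdv]
      have hη0 : 0 ≤ η := by
        have hl := Real.log_nonneg (by exact_mod_cast Fintype.card_pos : (1 : ℝ) ≤ Fintype.card V)
        by_contra hneg
        nlinarith
      nlinarith [hlow v]
    linarith
  have hsum := hbreg.trans (Finset.sum_le_sum fun v _ => hterm v)
  rw [Finset.sum_const, Finset.card_univ, nsmul_eq_mul] at hsum
  rw [← Real.log_le_log_iff hpos (by positivity), Real.log_pow, Real.log_div (by positivity)
    (by positivity), Real.log_mul hDpos.ne' (by positivity), Real.log_exp, Real.log_exp]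
  linarith

/-- The loss is `(nB)^k / k! = s⁻¹^k * (sBn)^k / k!`, and the last quotient is at most `exp (sBn)`.
A small `s` makes the exponential cheap, after which `k / n` is taken small against `log s⁻¹`. -/
theorem card_adjPermsLE_le_exp {x B s : ℝ} (hx : ∀ v, x ≤ G.degree v) (hs : 0 < s) {K : ℝ}
    (hK : 0 < K) (hxK : Fintype.card V + K ≤ 2 * x)
    (hB : 1 + 8 * (Fintype.card V : ℝ) ^ 2 / K ^ 2 ≤ B) (k : ℕ) (hk : k + 1 ≤ Fintype.card V) :
    ((G.adjPermsLE (k + 1)).card : ℝ) ≤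
      s⁻¹ ^ k * Real.exp (s * B * Fintype.card V) * (G.adjPermsLE 1).card := by
  have h := G.factorial_mul_card_adjPermsLE_le hx hK hxK k hk
  set n : ℝ := (Fintype.card V : ℝ) with hn
  have hn0 : 0 ≤ n := Nat.cast_nonneg _
  have hB0 : 0 ≤ B := le_trans (by positivity) hB
  have hexp := Real.pow_div_factorial_le_exp (s * B * n) (by positivity) k
  have hfac : (0 : ℝ) < k.factorial := by exact_mod_cast k.factorial_pos
  rw [div_le_iff₀ hfac] at hexp
  have h1 : (n * (1 + 8 * n ^ 2 / K ^ 2)) ^ k ≤ (n * B) ^ k := by gcongr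
  have h2 : (n * B) ^ k = s⁻¹ ^ k * (s * B * n) ^ k := by
    rw [← mul_pow]; congr 1; field_simp
  have h3 : ((k.factorial : ℕ) : ℝ) ≤ (k + 1).factorial := by
    exact_mod_cast Nat.factorial_le (Nat.le_succ k)
  refine le_of_mul_le_mul_left ?_ hfac
  calc (k.factorial : ℝ) * (G.adjPermsLE (k + 1)).card
      ≤ (k + 1).factorial * (G.adjPermsLE (k + 1)).card := by gcongr
    _ ≤ _ := h
    _ ≤ (s⁻¹ ^ k * (Real.exp (s * B * n) * k.factorial)) * (G.adjPermsLE 1).card := by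
        rw [h2] at h1
        gcongr
        exact h1.trans (by gcongr)
    _ = _ := by ring

theorem card_adjPerms_le_add (k : ℕ) :
    G.adjPerms.card ≤ (G.adjPermsLE k).card +
      ({σ : Perm V | k + 1 ≤ σ.numCycles} : Finset (Perm V)).card := by
  refine le_trans (Finset.card_le_card ?_) (Finset.card_union_le _ _)
  intro σ hσ
  simp only [adjPermsLE, Finset.mem_filter, Finset.mem_union, Finset.mem_univ, true_and]
  rcases Nat.lt_or_ge k σ.numCycles with h | h
  · exact .inr h
  · exact .inl ⟨hσ, h⟩

theorem _root_.Equiv.Perm.card_numCycles_ge_le [Nonempty V] {a θ : ℝ} (ha : 0 < a)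
    (hθ : 8 * Real.exp 1 / a ≤ (Fintype.card V : ℝ) ^ θ) {k : ℕ} (hk : θ * Fintype.card V ≤ k) :
    (({σ : Perm V | k ≤ σ.numCycles} : Finset (Perm V)).card : ℝ) ≤
      (a * Fintype.card V / Real.exp 1) ^ Fintype.card V / 2 := by
  have h : (({σ : Perm V | k ≤ σ.numCycles} : Finset (Perm V)).card : ℝ) *
      (Fintype.card V : ℝ) ^ k ≤ 4 ^ Fintype.card V * (Fintype.card V).factorial := by
    exact_mod_cast card_numCycles_ge_mul_pow_le (V := V) k
  have hfac : ((Fintype.card V).factorial : ℝ) ≤ (Fintype.card V : ℝ) ^ Fintype.card V := by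
    exact_mod_cast Nat.factorial_le_pow _
  have hN1 : 1 ≤ Fintype.card V := Fintype.card_pos
  set N := Fintype.card V with hN
  have hn1 : (1 : ℝ) ≤ N := by exact_mod_cast hN1
  have hn0 : (0 : ℝ) < N := by linarith
  -- In the constant `8`, a factor `4` cancels the `4 ^ N` of the cycle count; the remaining `2 ^ N
  -- ≥ 2` yields the final half.
  have hpow : (8 * Real.exp 1 / a) ^ N ≤ (N : ℝ) ^ k := by
    calc (8 * Real.exp 1 / a) ^ N ≤ ((N : ℝ) ^ θ) ^ N := by gcongr
      _ = (N : ℝ) ^ (θ * N) := by rw [Real.rpow_mul hn0.le, Real.rpow_natCast]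
      _ ≤ (N : ℝ) ^ (k : ℝ) := Real.rpow_le_rpow_of_exponent_le hn1 hk
      _ = _ := Real.rpow_natCast _ _
  have h8 : (8 * Real.exp 1 / a) ^ N * (a * N / Real.exp 1) ^ N = 2 ^ N * (4 ^ N * (N : ℝ) ^ N) := by
    rw [← mul_pow, ← mul_pow, ← mul_pow]; congr 1; field_simp; norm_num
  have h2 : (2 : ℝ) ≤ 2 ^ N := le_self_pow₀ (by norm_num) (by omega)
  set M := (({σ : Perm V | k ≤ σ.numCycles} : Finset (Perm V)).card : ℝ)
  have hM : 0 ≤ M := Nat.cast_nonneg _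
  have hE : 0 < (8 * Real.exp 1 / a) ^ N := by positivity
  refine le_of_mul_le_mul_left ?_ hE
  have h4 : (0 : ℝ) ≤ 4 ^ N * (N : ℝ) ^ N := by positivity
  calc (8 * Real.exp 1 / a) ^ N * M ≤ (N : ℝ) ^ k * M := by gcongr
    _ = M * (N : ℝ) ^ k := mul_comm _ _
    _ ≤ _ := h
    _ ≤ 4 ^ N * (N : ℝ) ^ N := by gcongr
    _ ≤ 2 ^ N * (4 ^ N * (N : ℝ) ^ N) / 2 := by nlinarith
    _ = _ := by rw [← h8]; ring

/-- With `k = ⌊θn⌋`, at least half of the guaranteed permutations have at most `k + 1` cycles. The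
loss `exp (-3εn)` consists of `s⁻¹ ^ k`, of `exp (sBn)`, and of the polynomial factor `2n`, each at
most `exp (εn)`. -/
theorem pow_lt_numHamiltonCycles {x B s a θ ε : ℝ} (hx : ∀ v, x ≤ G.degree v) {K : ℝ}
    (hK : 0 < K) (hxK : Fintype.card V + K ≤ 2 * x)
    (hB : 1 + 8 * (Fintype.card V : ℝ) ^ 2 / K ^ 2 ≤ B) (hs : 0 < s) (hs1 : s ≤ 1)
    (hsB : s * B = ε) (hθ0 : 0 < θ) (hθ1 : θ ≤ 1 / 2) (hsθ : s⁻¹ ^ θ = Real.exp ε) (ha : 0 < a)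
    (hcard : (a * Fintype.card V / Real.exp 1) ^ Fintype.card V ≤ (G.adjPerms.card : ℝ))
    (hn3 : 3 ≤ Fintype.card V) (hθ : 8 * Real.exp 1 / a ≤ (Fintype.card V : ℝ) ^ θ)
    (hexp : 2 * (Fintype.card V : ℝ) < Real.exp (ε * Fintype.card V)) :
    (a * Real.exp (-(3 * ε)) * Fintype.card V / Real.exp 1) ^ Fintype.card V <
      (numHamiltonCycles G : ℝ) := by
  have : Nonempty V := Fintype.card_pos_iff.mp (by omega)
  set N := Fintype.card V with hN
  have hn3' : (3 : ℝ) ≤ N := by exact_mod_cast hn3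
  have hn0 : (0 : ℝ) < N := by linarith
  set k := ⌊θ * N⌋₊ with hk
  have hkle : (k : ℝ) ≤ θ * N := Nat.floor_le (by positivity)
  have hklt : θ * N < k + 1 := Nat.lt_floor_add_one _
  have hkN : k + 1 ≤ N := by
    have : (k : ℝ) + 1 ≤ N := by nlinarith
    exact_mod_cast this
  have hfew := G.card_adjPermsLE_le_exp hx hs hK hxK hB k hkN
  have hmany := Equiv.Perm.card_numCycles_ge_le (V := V) ha hθ (k := k + 1 + 1)
    (by push_cast; linarith)
  have hsplit : (G.adjPerms.card : ℝ) ≤ (G.adjPermsLE (k + 1)).card +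
      (({σ : Perm V | k + 1 + 1 ≤ σ.numCycles} : Finset (Perm V)).card : ℝ) := by
    exact_mod_cast G.card_adjPerms_le_add (k + 1)
  have hone : ((G.adjPermsLE 1).card : ℝ) ≤ N * numHamiltonCycles G := by
    exact_mod_cast card_adjPermsLE_one_le hn3
  have hsk : s⁻¹ ^ k ≤ Real.exp (ε * N) := by
    have hs1' : 1 ≤ s⁻¹ := (one_le_inv₀ hs).mpr hs1
    calc s⁻¹ ^ k = s⁻¹ ^ (k : ℝ) := (Real.rpow_natCast _ _).symm
      _ ≤ s⁻¹ ^ (θ * N) := Real.rpow_le_rpow_of_exponent_le hs1' hkle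
      _ = Real.exp (ε * N) := by rw [Real.rpow_mul (by positivity), hsθ, ← Real.exp_mul]
  rw [hsB] at hfew
  set E := Real.exp (ε * N) with hE
  have hE0 : 0 < E := Real.exp_pos _
  set H := (numHamiltonCycles G : ℝ) with hH
  have hH0 : 0 ≤ H := Nat.cast_nonneg _
  set Q := (a * N / Real.exp 1) ^ N with hQ
  have hQ0 : 0 < Q := by positivity
  have hbig : Q ≤ 2 * (E * E * (N * H)) := by
    have : ((G.adjPermsLE (k + 1)).card : ℝ) ≤ E * E * (N * H) :=
      hfew.trans (by gcongr)
    linarith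
  have hlhs : (a * Real.exp (-(3 * ε)) * N / Real.exp 1) ^ N * (E * E * E) = Q := by
    have h3 : Real.exp (-(3 * ε)) ^ N * (E * E * E) = 1 := by
      rw [← Real.exp_nat_mul, hE, ← Real.exp_add, ← Real.exp_add, ← Real.exp_add, ← Real.exp_zero]
      congr 1; ring
    calc _ = (a * N / Real.exp 1) ^ N * (Real.exp (-(3 * ε)) ^ N * (E * E * E)) := by
          rw [show a * Real.exp (-(3 * ε)) * N / Real.exp 1 =
            (a * N / Real.exp 1) * Real.exp (-(3 * ε)) by ring, mul_pow, mul_assoc]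
      _ = _ := by rw [h3, mul_one]
  have hHpos : 0 < H := by
    rcases hH0.eq_or_lt with h | h
    · rw [← h] at hbig; simp at hbig; linarith
    · exact h
  refine lt_of_mul_lt_mul_right ?_ (by positivity : 0 ≤ E * E * E)
  rw [hlhs]
  calc Q ≤ 2 * (E * E * (N * H)) := hbig
    _ = (2 * N) * (E * E * H) := by ring
    _ < E * (E * E * H) := by gcongr
    _ = _ := by ring

end SimpleGraph

/-! ### Choice of constants and conclusion -/

theorem exists_forall_ge_growth_bounds {b θ ε : ℝ} (hθ : 0 < θ) (hε : 0 < ε) :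
    ∃ N : ℕ, ∀ n : ℕ, N ≤ n → 3 ≤ n ∧ b ≤ (n : ℝ) ^ θ ∧ 2 * (n : ℝ) < Real.exp (ε * n) ∧
      4 * (Real.log n + 1) ≤ ε * n := by
  have h1 : ∀ᶠ n : ℕ in atTop, b ≤ (n : ℝ) ^ θ :=
    ((tendsto_rpow_atTop hθ).comp tendsto_natCast_atTop_atTop).eventually_ge_atTop b
  have h2 : ∀ᶠ n : ℕ in atTop, 4 / ε ^ 2 < (n : ℝ) :=
    tendsto_natCast_atTop_atTop.eventually_gt_atTop _
  have h3 : ∀ᶠ n : ℕ in atTop, ‖Real.log (n : ℝ)‖ ≤ ε / 8 * ‖(n : ℝ)‖ :=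
    tendsto_natCast_atTop_atTop.eventually
      (Real.isLittleO_log_id_atTop.def (by positivity : (0 : ℝ) < ε / 8))
  have h4 : ∀ᶠ n : ℕ in atTop, 8 / ε < (n : ℝ) :=
    tendsto_natCast_atTop_atTop.eventually_gt_atTop _
  obtain ⟨N, hN⟩ := eventually_atTop.mp
    ((eventually_ge_atTop 3).and (h1.and (h2.and (h3.and h4))))
  refine ⟨N, fun n hn => ?_⟩
  obtain ⟨g0, g1, g2, g3, g4⟩ := hN n hn
  have hn0 : (0 : ℝ) ≤ n := Nat.cast_nonneg n
  refine ⟨g0, g1, ?_, ?_⟩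
  · have hq := Real.quadratic_le_exp_of_nonneg (x := ε * n) (by positivity)
    rw [div_lt_iff₀ (by positivity)] at g2
    have : 0 ≤ ε * n := by positivity
    nlinarith
  · rw [Real.norm_of_nonneg hn0] at g3
    have := (Real.le_norm_self _).trans g3
    rw [div_lt_iff₀ hε] at g4
    linarith

theorem mainTheorem5 (c : ℝ) (hc : 1 / 2 < c) :
    ∃ ε₀ : ℝ, 0 < ε₀ ∧ ∃ ε' : ℝ → ℝ, Tendsto ε' (𝓝[>] 0) (𝓝 0) ∧
      ∀ ε : ℝ, 0 < ε → ε < ε₀ →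
        0 < ε' ε ∧ ε' ε < c ∧
        ∃ N : ℕ, ∀ n : ℕ, N ≤ n →
          ∀ (V : Type*) [Fintype V] [DecidableEq V] (G : SimpleGraph V) [DecidableRel G.Adj],
            Fintype.card V = n →
            (∀ v : V, (c - ε) * (n : ℝ) < (G.degree v : ℝ) ∧
              (G.degree v : ℝ) < (c + ε) * (n : ℝ)) →
            ((c - ε' ε) * (n : ℝ) / Real.exp 1) ^ n < (numHamiltonCycles G : ℝ) ∧
              (numHamiltonCycles G : ℝ) < ((c + ε' ε) * (n : ℝ) / Real.exp 1) ^ n := by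
  obtain ⟨κ, hκ⟩ : ∃ κ, κ = 2 * c - 1 := ⟨_, rfl⟩
  have hκ0 : 0 < κ := by linarith
  have hc0 : 0 < c := by linarith
  -- The terms of `C` absorb the losses `exp (-3ε)` and `1 + 8ε/κ` below and `exp ε` above.
  obtain ⟨C, hC⟩ : ∃ C, C = 4 + 5 * c + 8 * c / κ := ⟨_, rfl⟩
  have hcκ : 0 < 8 * c / κ := by positivity
  have hC0 : 0 < C := by linarith
  -- The bound `κ / 8` keeps the equalised matrix nonnegative, `1 / 8` keeps `log s⁻¹` away from
  -- zero and `θ ≤ 1 / 2`, and `c / (2C)` gives `ε' < c`.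
  refine ⟨min (κ / 8) (min (1 / 8) (c / (2 * C))), by positivity, fun ε => C * ε, ?_, ?_⟩
  · have : Tendsto (fun ε : ℝ => C * ε) (𝓝 0) (𝓝 (C * 0)) := tendsto_id.const_mul C
    rw [mul_zero] at this
    exact this.mono_left nhdsWithin_le_nhds
  intro ε hε hε₀
  rw [lt_min_iff, lt_min_iff, lt_div_iff₀ (by positivity : 0 < 2 * C)] at hε₀
  obtain ⟨hεκ, hε8, hεC⟩ := hε₀
  have hε'c : C * ε < c := by nlinarith
  refine ⟨by positivity, hε'c, ?_⟩
  -- With `y - x = 2εn` and `K = κn/2`, this is `2 * (y - x) / K`, and `B` below is `1 + 8n² / K²`.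
  set t := 8 * ε / κ with ht
  have ht0 : 0 < t := by positivity
  have hcε : 0 < c - ε := by linarith
  set a := (c - ε) / (1 + t) with ha
  have ha0 : 0 < a := by positivity
  set B := 1 + 32 / κ ^ 2 with hB
  have hB1 : 1 < B := by have : 0 < 32 / κ ^ 2 := by positivity
                         linarith
  set s := ε / B with hs
  have hs0 : 0 < s := by positivity
  have hsε : s ≤ ε := div_le_self hε.le hB1.le
  have hlog : 7 / 8 ≤ Real.log s⁻¹ := by
    have := Real.one_sub_inv_le_log_of_pos (inv_pos.mpr hs0)
    rw [inv_inv] at this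
    linarith
  set θ := ε / Real.log s⁻¹ with hθ
  have hθ0 : 0 < θ := div_pos hε (by linarith)
  have hθ1 : θ ≤ 1 / 2 := by
    rw [hθ, div_le_iff₀ (by linarith)]; linarith
  have hsθ : s⁻¹ ^ θ = Real.exp ε := by
    rw [Real.rpow_def_of_pos (inv_pos.mpr hs0), hθ, mul_div_cancel₀ _ (by linarith)]
  have hlower : c - C * ε ≤ a * Real.exp (-(3 * ε)) := by
    have h1 : 1 - 3 * ε ≤ Real.exp (-(3 * ε)) := by
      linarith [Real.add_one_le_exp (-(3 * ε))]
    refine le_trans ?_ (mul_le_mul_of_nonneg_left h1 ha0.le)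
    rw [ha, div_mul_eq_mul_div, le_div_iff₀ (by positivity)]
    have h2 : C * ε = 4 * ε + 5 * c * ε + c * t := by rw [hC, ht]; ring
    nlinarith [mul_pos hC0 (mul_pos hε ht0), mul_pos hc0 hε, mul_pos hε hε]
  have hupper : (c + ε) * Real.exp ε < c + C * ε := by
    have h1 : 1 - ε ≤ Real.exp (-ε) := by linarith [Real.add_one_le_exp (-ε)]
    have h2 : c + ε < (c + C * ε) * (1 - ε) := by
      have : 4 * ε + 5 * c * ε ≤ C * ε := by
        rw [hC]; nlinarith
      nlinarith [mul_pos hc0 hε, mul_pos hC0 hε]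
    have h3 : c + ε < (c + C * ε) * Real.exp (-ε) :=
      h2.trans_le (mul_le_mul_of_nonneg_left h1 (by positivity))
    rw [Real.exp_neg, ← div_eq_mul_inv, lt_div_iff₀ (Real.exp_pos _)] at h3
    exact h3
  obtain ⟨N, hN⟩ := exists_forall_ge_growth_bounds (b := 8 * Real.exp 1 / a) hθ0 hε
  refine ⟨N, fun n hn V _ _ G _ hV hdeg => ?_⟩
  obtain ⟨hn3, hnθ, hnexp, hnlog⟩ := hN n hn
  subst hV
  have : Nonempty V := Fintype.card_pos_iff.mp (by omega)
  set n := Fintype.card V with hndef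
  have hn0 : (0 : ℝ) < n := by exact_mod_cast (by omega : 0 < n)
  have hx : ∀ v, (c - ε) * n ≤ G.degree v := fun v => (hdeg v).1.le
  have hy : ∀ v, (G.degree v : ℝ) ≤ (c + ε) * n := fun v => (hdeg v).2.le
  have hK0 : 0 < κ * n / 2 := by positivity
  have hxK : (n : ℝ) + κ * n / 2 ≤ 2 * ((c - ε) * n) := by
    have : 0 ≤ (κ / 2 - 2 * ε) * n := by
      apply mul_nonneg _ hn0.le; linarith
    nlinarith
  constructor
  · have hperm := G.pow_le_mul_card_adjPerms (by positivity) hx hy hK0 hxK (by nlinarith)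
    have ht' : 2 * ((c + ε) * n - (c - ε) * n) / (κ * n / 2) = t := by
      rw [ht]; field_simp; ring
    rw [ht'] at hperm
    have hcard : (a * n / Real.exp 1) ^ n ≤ (G.adjPerms.card : ℝ) := by
      rw [show a * n / Real.exp 1 = (c - ε) * n / (Real.exp 1 * (1 + t)) by
        rw [ha]; field_simp, div_pow, div_le_iff₀ (by positivity), mul_comm]
      rw [mul_comm] at hperm
      linarith
    have hB' : 1 + 8 * (n : ℝ) ^ 2 / (κ * n / 2) ^ 2 ≤ B := by
      rw [hB]; apply le_of_eq; field_simp; ring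
    refine lt_of_le_of_lt ?_ (G.pow_lt_numHamiltonCycles hx hK0 hxK hB' hs0 (by linarith)
      (div_mul_cancel₀ _ (by linarith)) hθ0 hθ1 hsθ ha0 hcard hn3 hnθ hnexp)
    have : 0 ≤ c - C * ε := by linarith
    gcongr
  · have hle := G.card_adjPerms_le_pow (fun v => le_trans (by nlinarith) (hx v)) hy hnlog
    have hham : (numHamiltonCycles G : ℝ) ≤ G.adjPerms.card := by
      exact_mod_cast SimpleGraph.numHamiltonCycles_le_card_adjPerms
    refine hham.trans_lt (hle.trans_lt ?_)
    refine pow_lt_pow_left₀ ?_ (by positivity) (by omega)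
    refine div_lt_div_of_pos_right ?_ (Real.exp_pos 1)
    calc (c + ε) * n * Real.exp ε = (c + ε) * Real.exp ε * n := by ring
      _ < _ := mul_lt_mul_of_pos_right hupper hn0
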